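/- **Model.** Fix integers $n\ge 1$ (committee size), $\Delta\ge 1$ (network delay bound, in slots) and $m\ge1$ (epoch length, in blocks). Time is slotted and clocks are synchronized; $\lambda$ is the security parameter; "negligible" and "with overwhelming probability" refer to $\lambda$. There are nodes $0,1,\dots,N-1$ with $N\ge n$, each with a generated key pair, and external clients. All parties know $\lambda$, the public keys, and the initial set of active validators $\{0,\dots,n-1\}$ (common knowledge); there is no other trusted party, setup, or timestamping service. Every party outputs a chain in each slot in which it is online: a list of blocks, each a list of transactions. The active set is determined by the chain: nodes stake in order to enter a queue, and at the end of each epoch of $m$ blocks the active validators with a withdrawal request in the chain are replaced by nodes from the queue (a request stays pending while the queue is empty), so that there are always $n$ active validators. A party also outputs the set of validators whose stake is released in its view; a validator has *withdrawn* in a client's view by slot $r$ if its stake was released in that view by slot $r$. A PoS protocol consists of a probabilistic program executed in each slot by every node that participates (validators broadcast messages; external clients only receive), a forensic procedure that maps the transcripts of clients and honest validators to a proof, and a public rule telling which nodes a proof identifies as protocol violators. The adversary, together with the environment, is a probabilistic polynomial-time algorithm. It corrupts a set of nodes before the execution starts; it tells nodes to stake or to withdraw and inputs transactions; it decides when external clients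 are online; it sends arbitrary messages in the name of adversarial nodes, possibly different ones to different parties; and it may present proofs to the clients. It sees all messages. It delivers the messages of each honest node in order and within $\Delta$ slots, and late-coming nodes and clients receive all past messages, except possibly those of the most recent $\Delta-1$ slots. A validator that becomes inactive after it was told to withdraw counts as adversarial from then on, and the adversary may take over its state and control (posterior corruption). Clients are the external clients and the honest nodes. *Standing assumptions on the protocol.* (a) In executions in which all nodes follow the protocol, every party runs in time polynomial in $\lambda$, $N$, the number of slots and the size of the input. (b) Withdrawals take finite time: there is a polynomially bounded $T=T(\lambda)$ such that, against every adversary that corrupts nobody initially and provides a candidate for every leaving validator, with overwhelming probability, if the withdrawal request of an active honest validator is in the chains of all clients from slot $u$ on, then its stake is released in the view of every client that is online in a slot $\ge u+T$. *Safety violation:* two chains $L,L'$ output by clients (possibly in different slots) with neither a prefix of the other, or a client's earlier chain that is not a prefix of its later chain. A validator $v$ is *slashable* in the view of client $c$ in slot $r$ if $c$ has come online by slot $r$, by slot $r$ the clients have got a proof (generated by the forensic procedure after a safety violation, or presented by the adversary) that identifies $v$ as a protocol violator, and $v$ has not withdrawn in $c$'s view by slot $r$. *$f_s$-slashable-safety:*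 against every probabilistic polynomial-time adversary, whatever the number of corruptions, with overwhelming probability, if there is a safety violation then (i) there are at least $f_s$ adversarial validators each of which becomes slashable in the view of all clients, and (ii) no honest validator becomes slashable in any client's view. *$f_l$-$T_{\mathrm{fin}}$-liveness:* against every probabilistic polynomial-time adversary that initially corrupts at most $f_l$ nodes, with overwhelming probability, every transaction that is input to an active honest validator in a slot $r$ is in the chain of every client in every slot $\ge r+T_{\mathrm{fin}}(\lambda)$ in which it is online. **Theorem.** For all integers $f_s,f_l>0$ and every polynomially bounded $T_{\mathrm{fin}}$, no PoS protocol satisfying (a) and (b) provides both $f_s$-slashable-safety and $f_l$-$T_{\mathrm{fin}}$-liveness. -/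

import Mathlib

namespace PoS

/-! ### Computation: binary trees and programs with a step count -/

/-- Data handled by algorithms: finite binary trees. -/
inductive Data : Type
  | leaf : Data
  | node : Data → Data → Data

namespace Data

/-- Number of vertices. -/
def size : Data → ℕ
  | leaf => 1
  | node a b => 1 + a.size + b.size

/-- Every tree is read as a list: `leaf` is the empty list, `node a b` has head `a` and tail `b`. -/
def toList : Data → List Data
  | leaf => []
  | node a b => a :: b.toList

def ofList : List Data → Data
  | [] => leaf
  | a :: l => node a (ofList l)

/-- The length of a tree read as a list; this is also how a tree is read as a number. -/
def len (d : Data) : ℕ := d.toList.length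

/-- The `i`-th entry of a tree read as a list (`leaf` if there is none). -/
def nth (d : Data) (i : ℕ) : Data := d.toList.getD i leaf

/-- Unary numbers. -/
def ofNat (k : ℕ) : Data := ofList (List.replicate k leaf)

def ofBool : Bool → Data
  | false => leaf
  | true => node leaf leaf

/-- Flags: `leaf` is read as false, everything else as true. -/
def flag : Data → Bool
  | leaf => false
  | node _ _ => true

def fst : Data → Data
  | leaf => leaf
  | node a _ => a

def snd : Data → Data
  | leaf => leaf
  | node _ b => b

/-- A string of bits as a tree. -/
def ofBits {k : ℕ} (c : Fin k → Bool) : Data := ofList (List.ofFn fun j => ofBool (c j))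

end Data

/-- Programs on trees: pairing, projections, composition, branching, and loops whose number of
iterations is read off the data. -/
inductive Prog : Type
  | id : Prog
  | nil : Prog
  | fst : Prog
  | snd : Prog
  | pair : Prog → Prog → Prog
  | comp : Prog → Prog → Prog
  | ite : Prog → Prog → Prog → Prog
  | loop : Prog → Prog

namespace Prog

/-- The function computed by a program. `loop p`, on `node a b`, applies `p` to `b` as many times
as `a` is long. -/
def eval : Prog → Data → Data
  | id, x => x
  | nil, _ => .leaf
  | fst, x => x.fst
  | snd, x => x.snd
  | pair p q, x => .node (p.eval x) (q.eval x)
  | comp p q, x => p.eval (q.eval x)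
  | ite c p q, x => if (c.eval x).flag then p.eval x else q.eval x
  | loop p, x => p.eval^[x.fst.len] x.snd

/-- The running time of a program on an input. An elementary operation costs the size of the tree
that it works on, so no tree can be produced faster than it can be written down. -/
def cost : Prog → Data → ℕ
  | id, x => 1 + x.size
  | nil, x => 1 + x.size
  | fst, x => 1 + x.size
  | snd, x => 1 + x.size
  | pair p q, x => 1 + p.cost x + q.cost x
  | comp p q, x => 1 + q.cost x + p.cost (q.eval x)
  | ite c p q, x => 1 + c.cost x + (if (c.eval x).flag then p.cost x else q.cost x)
  | loop p, x => 1 + x.size + ∑ t ∈ Finset.range x.fst.len, p.cost (p.eval^[t] x.snd)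

end Prog

/-- Bounded by a polynomial. -/
def PolyBounded (f : ℕ → ℕ) : Prop := ∃ p : Polynomial ℕ, ∀ κ, f κ ≤ p.eval κ

/-- Negligible functions of the security parameter. -/
def Negligible (f : ℕ → ℝ) : Prop :=
  Asymptotics.SuperpolynomialDecay Filter.atTop (fun κ : ℕ => (κ : ℝ)) f

/-- Probability of an event under the uniform distribution on a finite space of coin tosses. -/
noncomputable def prob {Ω : Type} (E : Set Ω) : ℝ := (Nat.card E : ℝ) / (Nat.card Ω : ℝ)

/-! ### Transactions, chains, and the staking contract -/

/-- A payload transaction. -/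
def payTx (d : Data) : Data := .node .leaf d

/-- The request of node `i` to lock up its stake and enter the queue of candidates. -/
def stakeTx (i : ℕ) : Data := .node (.ofNat 1) (.ofNat i)

/-- The request of validator `i` to leave the active set and to retrieve its stake. -/
def withdrawTx (i : ℕ) : Data := .node (.ofNat 2) (.ofNat i)

/-- A chain is a list of blocks; each block, read as a list, is its list of transactions. -/
abbrev Chain : Type := List Data

/-- All transactions of a chain, in order. -/
def Chain.txs (L : Chain) : List Data := L.flatMap Data.toList

/-- State of the staking contract. -/
structure Registry where
  /-- the active validators of the current epoch -/
  active : List ℕ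
  /-- candidates that have staked and wait for a seat -/
  queue : List ℕ
  /-- active validators whose withdrawal request has not taken effect yet -/
  leaving : List ℕ
  /-- all nodes that have ever staked -/
  known : List ℕ

namespace Registry

def applyTx (g : Registry) (t : Data) : Registry :=
  let i := t.snd.len
  if t.fst.len = 1 then
    if i ∈ g.known then g else { g with queue := g.queue ++ [i], known := g.known ++ [i] }
  else if t.fst.len = 2 then
    if i ∈ g.active ∧ i ∉ g.leaving then { g with leaving := g.leaving ++ [i] } else g
  else g

/-- The next candidate takes the seat of `i`; without a candidate, `i` has to stay. -/
def replace (g : Registry) (i : ℕ) : Registry :=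
  match g.queue with
  | [] => g
  | j :: q =>
    { g with
      active := g.active.map fun a => if a = i then j else a
      queue := q
      leaving := g.leaving.erase i }

/-- At the end of an epoch the leaving validators are replaced from the queue. -/
def closeEpoch (g : Registry) : Registry := g.leaving.foldl replace g

end Registry

/-- The contract state after a chain, for epochs of `m` blocks and the initial active set
`{0, …, n - 1}`. -/
def registry (n m : ℕ) (L : Chain) : Registry :=
  L.zipIdx.foldl
    (fun g b =>
      let g' := b.1.toList.foldl Registry.applyTx g
      if (b.2 + 1) % m = 0 then g'.closeEpoch else g')
    { active := List.range n, queue := [], leaving := [], known := List.range n }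

/-! ### Protocols and attackers -/

/-- The nodes `0, 1, 2, …` (active validators, candidates, former validators), and external
clients. -/
inductive Party : Type
  | node : ℕ → Party
  | client : ℕ → Party

/-- What a party records in a slot: the messages that it received, the chain that it outputs, and
the validators whose stake is released in its view. -/
structure Entry where
  slot : ℕ
  inbox : Data
  chain : Chain
  released : List ℕ

/-- A proof-of-stake protocol. All nodes and clients know the security parameter, the public keys,
and the fact that the initially active validators are the nodes `0, …, committee - 1`. -/
structure Protocol where
  /-- number of active validators -/
  committee : ℕ
  committee_pos : 0 < committee
  /-- bound on the network delay, in slots -/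
  delay : ℕ
  delay_pos : 0 < delay
  /-- epoch length, in blocks -/
  epochLen : ℕ
  epochLen_pos : 0 < epochLen
  /-- number of random bits for key generation -/
  keyBits : Polynomial ℕ
  /-- number of random bits per party and slot -/
  coinBits : Polynomial ℕ
  /-- key generation: `(1^κ, coins)` to `(public key, secret key)` -/
  keyGen : Prog
  /-- the code that validators and clients execute in every slot:
  `[1^κ, public keys, role, slot, state, inbox, input transactions, coins]` to
  `[new state, broadcast message, chain, released validators]` -/
  step : Prog
  /-- the forensic protocol: from the public data and the transcripts to a proof -/
  forensic : (κ : ℕ) → (pks : Data) → (Party → List Entry) → Data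
  /-- the nodes that a proof identifies as protocol violators; this can be checked by everybody,
  from the public data alone -/
  accused : (κ : ℕ) → (pks : Data) → (proof : Data) → List ℕ

/-- The adversary together with the environment. -/
structure Attacker where
  /-- number of nodes besides the initial validators, of external clients, and of slots -/
  candidates : Polynomial ℕ
  clients : Polynomial ℕ
  slots : Polynomial ℕ
  /-- the random bits of the attacker in a slot come in `blocks` many strings -/
  blocks : ℕ
  blockBits : Fin blocks → Polynomial ℕ
  /-- the initial corruptions: `1^κ` to a list of flags -/
  corrupt : Prog
  /-- the code that the attacker executes in every slot:
  `[1^κ, public keys, secret keys of the corrupted nodes, slot, state,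
  messages broadcast in the previous slot, states of the seized nodes, coins]` to
  `[new state, orders for the nodes, orders for the clients, proofs]`.
  The orders for a node are
  `[stake flag, withdrawal flag, payloads, network orders, seize flag]`, those for a client are
  `[online flag, network orders]`. Network orders list, for each sender, how many slots its latest
  messages are held back, and the messages that are sent in its name if it is adversarial. -/
  step : Prog

/-- The number of nodes of an execution. -/
noncomputable def Attacker.numNodes (A : Attacker) (P : Protocol) (κ : ℕ) : ℕ :=
  P.committee + A.candidates.eval κ

/-! ### Executions -/

/-- The local situation of a party. -/
structure Local where
  state : Data
  /-- `cursor j = t`: all messages that node `j` sent before slot `t` have been received -/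
  cursor : ℕ → ℕ
  log : List Entry
  /-- total running time so far -/
  time : ℕ

/-- The public situation of a node. -/
structure NodeInfo where
  /-- it takes part in the network: it is an initial validator, or it has been told to stake -/
  joined : Bool
  /-- it has entered the active set -/
  entered : Bool
  /-- it has been told to withdraw -/
  asked : Bool
  /-- it has become inactive; from then on it counts as adversarial -/
  left : Bool
  /-- it has become inactive, and the attacker has taken over its state and control -/
  seized : Bool
  /-- broadcast messages with their slots, the latest first -/
  sent : List (ℕ × Data)

structure World where
  loc : Party → Local
  info : ℕ → NodeInfo
  advState : Data
  advTime : ℕ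
  /-- transactions input to active honest validators, with their slots -/
  submitted : List (ℕ × Data)
  /-- proofs presented to the clients by the attacker, with their slots -/
  proofs : List (ℕ × Data)
  /-- total size of the transactions input so far -/
  load : ℕ

/-- The data that are fixed before the first slot. -/
structure Session where
  prot : Protocol
  att : Attacker
  κ : ℕ
  /-- the key pairs of the nodes -/
  key : ℕ → Data

namespace Session

variable (s : Session)

noncomputable def N : ℕ := s.att.numNodes s.prot s.κ

noncomputable def K : ℕ := s.att.clients.eval s.κ

/-- The nodes that are corrupted before the execution starts. -/
def corrupt (i : ℕ) : Bool := ((s.att.corrupt.eval (.ofNat s.κ)).nth i).flag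

/-- A list of trees indexed by the nodes. -/
noncomputable def perNode (f : ℕ → Data) : Data := .ofList ((List.range s.N).map f)

noncomputable def pks : Data := s.perNode fun i => (s.key i).fst

/-- The active set after a chain. -/
def active (L : Chain) : List ℕ := (registry s.prot.committee s.prot.epochLen L).active

/-- Nodes start with their secret key as their state, and may erase it later. -/
def init : World where
  loc
    | .node i => { state := (s.key i).snd, cursor := fun _ => 0, log := [], time := 0 }
    | .client _ => { state := .leaf, cursor := fun _ => 0, log := [], time := 0 }
  info i :=
    { joined := decide (i < s.prot.committee), entered := decide (i < s.prot.committee)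
      asked := false, left := false, seized := false, sent := [] }
  advState := .leaf
  advTime := s.att.corrupt.cost (.ofNat s.κ)
  submitted := []
  proofs := []
  load := 0

/-- What the attacker is given in slot `r`. -/
noncomputable def advInput (r : ℕ) (w : World) (coins : Data) : Data :=
  .ofList
    [.ofNat s.κ, s.pks, s.perNode fun i => if s.corrupt i then (s.key i).snd else .leaf,
      .ofNat r, w.advState,
      s.perNode fun i =>
        .ofList (((w.info i).sent.filter fun m => m.1 + 1 = r).map Prod.snd),
      s.perNode fun i => if (w.info i).seized then (w.loc (.node i)).state else .leaf,
      coins]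

/-- In what follows `o` is the output of the attacker in slot `r`. -/
def nodeOrder (o : Data) (i : ℕ) : Data := (o.nth 1).nth i

def clientOrder (o : Data) (c : ℕ) : Data := (o.nth 2).nth c

/-- Inactive nodes can be taken over (posterior corruption). -/
def seized (w : World) (o : Data) (i : ℕ) : Bool :=
  (w.info i).seized || ((w.info i).left && ((nodeOrder o i).nth 4).flag)

/-- A node joins the network when it is told to stake. -/
def joined (w : World) (o : Data) (i : ℕ) : Bool := (w.info i).joined || ((nodeOrder o i).nth 0).flag

/-- Node `i` executes the code of the protocol in this slot. -/
noncomputable def runs (w : World) (o : Data) (i : ℕ) : Bool :=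
  decide (i < s.N) && !s.corrupt i && joined w o i && !seized w o i

/-- External client `c` is online in this slot. -/
noncomputable def online (o : Data) (c : ℕ) : Bool :=
  decide (c < s.K) && ((clientOrder o c).nth 0).flag

def netOrder (o : Data) : Party → Data
  | .node i => (nodeOrder o i).nth 3
  | .client c => (clientOrder o c).nth 1

/-- Messages of sender `j` are delivered to `p` in their order, at the latest `delay` slots after
they were sent, or as soon as `p` is online thereafter. -/
def cursor (r : ℕ) (w : World) (o : Data) (p : Party) (j : ℕ) : ℕ :=
  max ((w.loc p).cursor j)
    (r - min ((netOrder o p).nth j).fst.len (s.prot.delay - 1))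

/-- The messages that `p` receives from `j` in slot `r`, the latest first (a party that comes online
for the first time receives the whole past traffic): those that the attacker
sends if `j` is adversarial, and those that `j` sent when it executed the protocol. -/
def received (r : ℕ) (w : World) (o : Data) (p : Party) (j : ℕ) : List Data :=
  (if s.corrupt j || seized w o j then ((netOrder o p).nth j).snd.toList else []) ++
    ((w.info j).sent.filter fun m =>
      decide ((w.loc p).cursor j ≤ m.1) && decide (m.1 < s.cursor r w o p j)).map Prod.snd

noncomputable def inbox (r : ℕ) (w : World) (o : Data) (p : Party) : Data :=
  s.perNode fun j => .ofList (s.received r w o p j)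

/-- Transactions input to node `i`, apart from its own request to stake. -/
def tasks (o : Data) (i : ℕ) : List Data :=
  (if ((nodeOrder o i).nth 1).flag then [withdrawTx i] else []) ++
    ((nodeOrder o i).nth 2).toList.map payTx

def inputs (o : Data) : Party → List Data
  | .node i => (if ((nodeOrder o i).nth 0).flag then [stakeTx i] else []) ++ tasks o i
  | .client _ => []

def role : Party → Data
  | .node i => .node .leaf (.ofNat i)
  | .client _ => .leaf

/-- What the code of party `p` is given in slot `r`. -/
noncomputable def stepInput (r : ℕ) (w : World) (o : Data) (coins : Data) (p : Party) : Data :=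
  .ofList
    [.ofNat s.κ, s.pks, role p, .ofNat r, (w.loc p).state, s.inbox r w o p,
      .ofList (inputs o p), coins]

/-- What the code of party `p` outputs in slot `r`. -/
noncomputable def stepOutput (r : ℕ) (w : World) (o : Data) (coins : Data) (p : Party) : Data :=
  s.prot.step.eval (s.stepInput r w o coins p)

/-- The party `p` executes its code in slot `r`; what it records counts as the record of a client
if `visible` holds. -/
noncomputable def stepLocal (r : ℕ) (w : World) (o : Data) (coins : Data) (p : Party) (visible : Bool) : Local :=
  let y := s.stepOutput r w o coins p
  { state := y.nth 0
    cursor := s.cursor r w o p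
    log :=
      if visible then
        { slot := r, inbox := s.inbox r w o p, chain := (y.nth 2).toList,
          released := (y.nth 3).toList.map Data.len } :: (w.loc p).log
      else (w.loc p).log
    time := (w.loc p).time + s.prot.step.cost (s.stepInput r w o coins p) }

noncomputable def stepInfo (r : ℕ) (w : World) (o : Data) (coins : Data) (i : ℕ) : NodeInfo :=
  let v := w.info i
  let y := s.stepOutput r w o coins (.node i)
  let act : Bool := decide (i ∈ s.active (y.nth 2).toList)
  { joined := joined w o i
    entered := v.entered || act
    asked := v.asked || ((nodeOrder o i).nth 1).flag
    left := v.left || (v.asked && v.entered && !act)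
    seized := seized w o i
    sent := (r, y.nth 1) :: v.sent }

/-- Slot `r` of the execution: first the attacker acts, then the nodes and the clients. -/
noncomputable def next (r : ℕ) (w : World) (coins : Party → Data) (advCoins : Data) : World :=
  let x := s.advInput r w advCoins
  let o := s.att.step.eval x
  { loc := fun p =>
      match p with
      | .node i =>
        if s.runs w o i then
          s.stepLocal r w o (coins (.node i)) (.node i) (!(w.info i).left)
        else w.loc (.node i)
      | .client c =>
        if s.online o c then s.stepLocal r w o (coins (.client c)) (.client c) true
        else w.loc (.client c)
    info := fun i =>
      if s.runs w o i then s.stepInfo r w o (coins (.node i)) i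
      else { w.info i with joined := joined w o i, seized := seized w o i }
    advState := o.nth 0
    advTime := w.advTime + s.att.step.cost x
    submitted :=
      ((List.range s.N).flatMap fun i =>
        if s.runs w o i && (w.info i).entered && !(w.info i).left then
          (tasks o i).map fun t => (r, t)
        else []) ++ w.submitted
    proofs := (o.nth 3).toList.map (fun d => (r, d)) ++ w.proofs
    load := w.load +
      ∑ i ∈ Finset.range s.N,
        if s.runs w o i then ((inputs o (.node i)).map Data.size).sum else 0 }

end Session

/-- The coin tosses of an execution: those for the keys, and in every slot those of the nodes, of
the clients, and of the attacker. -/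
abbrev Coins (P : Protocol) (A : Attacker) (κ : ℕ) : Type :=
  (Fin (A.numNodes P κ) → Fin (P.keyBits.eval κ) → Bool) ×
    (Fin (A.slots.eval κ) →
      (Fin (A.numNodes P κ) → Fin (P.coinBits.eval κ) → Bool) ×
      (Fin (A.clients.eval κ) → Fin (P.coinBits.eval κ) → Bool) ×
      ((b : Fin A.blocks) → Fin ((A.blockBits b).eval κ) → Bool))

section Execution

variable (P : Protocol) (A : Attacker) (κ : ℕ) (ω : Coins P A κ)

noncomputable def session : Session where
  prot := P
  att := A
  κ := κ
  key i :=
    if h : i < A.numNodes P κ then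
      P.keyGen.eval (.node (.ofNat κ) (.ofBits (ω.1 ⟨i, h⟩)))
    else .leaf

noncomputable def partyCoins (r : Fin (A.slots.eval κ)) : Party → Data
  | .node i => if h : i < A.numNodes P κ then .ofBits ((ω.2 r).1 ⟨i, h⟩) else .leaf
  | .client c => if h : c < A.clients.eval κ then .ofBits ((ω.2 r).2.1 ⟨c, h⟩) else .leaf

noncomputable def attackerCoins (r : Fin (A.slots.eval κ)) : Data :=
  .ofList (List.ofFn fun b => .ofBits ((ω.2 r).2.2 b))

/-- The world before slot `r`. -/
noncomputable def worldAt : ℕ → World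
  | 0 => (session P A κ ω).init
  | r + 1 =>
    if h : r < A.slots.eval κ then
      (session P A κ ω).next r (worldAt r) (partyCoins P A κ ω ⟨r, h⟩)
        (attackerCoins P A κ ω ⟨r, h⟩)
    else worldAt r

/-- The world at the end of the execution. -/
noncomputable def final : World := worldAt P A κ ω (A.slots.eval κ)

end Execution

namespace Attacker

variable (A : Attacker)

def IsCorrupt (P : Protocol) (κ i : ℕ) : Prop :=
  i < A.numNodes P κ ∧ ((A.corrupt.eval (.ofNat κ)).nth i).flag = true

/-- The number of nodes that are corrupted before the execution starts. -/
noncomputable def corruptions (P : Protocol) (κ : ℕ) : ℕ := {i | A.IsCorrupt P κ i}.ncard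

/-- The attacker runs in probabilistic polynomial time. -/
def IsPPT (P : Protocol) : Prop :=
  ∃ p : Polynomial ℕ, ∀ κ (ω : Coins P A κ), (final P A κ ω).advTime ≤ p.eval κ

/-- There is always a candidate for every validator that is told to leave. -/
def FillsQueue (P : Protocol) : Prop :=
  ∀ κ (ω : Coins P A κ) (r : ℕ),
    {i | ((worldAt P A κ ω r).info i).asked = true}.ncard ≤
      {i | P.committee ≤ i ∧ i < A.numNodes P κ ∧
        ((worldAt P A κ ω r).info i).joined = true}.ncard

end Attacker

/-! ### Views, safety violations, slashing -/

namespace World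

variable (w : World)

/-- By slot `r`, the stake of `i` has been released in the view of `p`. -/
def WithdrawnBy (p : Party) (r i : ℕ) : Prop :=
  ∃ e ∈ (w.loc p).log, e.slot ≤ r ∧ i ∈ e.released

/-- By slot `r`, two chains have been output that contradict safety: neither is a prefix of the
other, or they come from one client and the earlier one is not a prefix of the later one. -/
def ViolatedBy (r : ℕ) : Prop :=
  ∃ p q, ∃ e ∈ (w.loc p).log, ∃ e' ∈ (w.loc q).log, e.slot ≤ r ∧ e'.slot ≤ r ∧
    ((¬ e.chain <+: e'.chain ∧ ¬ e'.chain <+: e.chain) ∨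
      (p = q ∧ e.slot ≤ e'.slot ∧ ¬ e.chain <+: e'.chain))

/-- The transcripts of all honest validators and clients up to slot `r`. -/
def transcripts (r : ℕ) (p : Party) : List Entry :=
  (w.loc p).log.filter fun e => e.slot ≤ r

end World

section Views

variable (P : Protocol) (A : Attacker) (κ : ℕ) (ω : Coins P A κ)

/-- Node `i` is honest throughout the execution. -/
def Honest (i : ℕ) : Prop :=
  i < A.numNodes P κ ∧ ¬ A.IsCorrupt P κ i ∧ ((final P A κ ω).info i).left = false

/-- Node `i` is or becomes adversarial. -/
def Adversarial (i : ℕ) : Prop :=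
  i < A.numNodes P κ ∧ (A.IsCorrupt P κ i ∨ ((final P A κ ω).info i).left = true)

/-- The clients of the execution: external clients and honest nodes that have ever been online. -/
def IsClient (p : Party) : Prop :=
  ((final P A κ ω).loc p).log ≠ [] ∧ ∀ i, p = .node i → Honest P A κ ω i

/-- By slot `r`, the clients have got a proof that identifies `i` as a protocol violator: one that
the forensic protocol generated after a safety violation, or one that the attacker presented. -/
def IdentifiedBy (r i : ℕ) : Prop :=
  ∃ t ≤ r, ∃ d, i ∈ P.accused κ (session P A κ ω).pks d ∧
    (((final P A κ ω).ViolatedBy t ∧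
        d = P.forensic κ (session P A κ ω).pks ((final P A κ ω).transcripts t)) ∨
      (t, d) ∈ (final P A κ ω).proofs)

/-- In slot `r`, node `i` is slashable in the view of `p`. -/
def SlashableAt (p : Party) (r i : ℕ) : Prop :=
  (∃ e ∈ ((final P A κ ω).loc p).log, e.slot ≤ r) ∧ IdentifiedBy P A κ ω r i ∧
    ¬ (final P A κ ω).WithdrawnBy p r i

/-- At least `f` adversarial validators become slashable in the view of all clients, and no honest
validator becomes slashable in the view of any client. -/
def RightlySlashable (f : ℕ) : Prop :=
  (∃ S : Finset ℕ, f ≤ S.card ∧ ∀ i ∈ S, Adversarial P A κ ω i ∧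
      ∀ p, IsClient P A κ ω p → ∃ r, SlashableAt P A κ ω p r i) ∧
    ∀ i, Honest P A κ ω i → ∀ p, IsClient P A κ ω p → ∀ r, ¬ SlashableAt P A κ ω p r i

/-- Transactions input to active honest validators are in the chains of all clients after `T`
slots. -/
def LiveWithin (T : ℕ) : Prop :=
  ∀ r t, (r, t) ∈ (final P A κ ω).submitted →
    ∀ p, ∀ e ∈ ((final P A κ ω).loc p).log, r + T ≤ e.slot → t ∈ e.chain.txs

/-- If the withdrawal request of an active honest validator is final from slot `u` on, then its
stake is released in the view of all clients after `T` more slots. -/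
def ReleasedWithin (T : ℕ) : Prop :=
  ∀ r i, (r, withdrawTx i) ∈ (final P A κ ω).submitted → ∀ u, r ≤ u →
    (∀ p, ∀ e ∈ ((final P A κ ω).loc p).log, u ≤ e.slot → withdrawTx i ∈ e.chain.txs) →
    ∀ p, ∀ e ∈ ((final P A κ ω).loc p).log, u + T ≤ e.slot →
      (final P A κ ω).WithdrawnBy p e.slot i

end Views

namespace Protocol

variable (P : Protocol)

/-- In every execution in which all nodes follow the protocol, the running time of each party up to
slot `r` is polynomial in the security parameter, the number of nodes, `r`, and the total size of
the input transactions. -/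
def Efficient : Prop :=
  ∃ p : Polynomial ℕ, ∀ (A : Attacker) κ (ω : Coins P A κ) (r : ℕ), A.corruptions P κ = 0 →
    (∀ i, ((worldAt P A κ ω r).info i).seized = false) →
    ∀ q, ((worldAt P A κ ω r).loc q).time ≤
      p.eval (κ + A.numNodes P κ + r + (worldAt P A κ ω r).load)

/-- The time between the finalization of a withdrawal request and the release of the stake is at
most `T`, with overwhelming probability, provided that nobody is corrupted at the beginning and
that there are enough candidates to replace the leaving validators. -/
def WithdrawalDelay (T : ℕ → ℕ) : Prop :=
  ∀ A : Attacker, A.IsPPT P → (∀ κ, A.corruptions P κ = 0) → A.FillsQueue P →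
    Negligible fun κ => prob {ω : Coins P A κ | ¬ ReleasedWithin P A κ ω (T κ)}

/-- `f`-slashable-safety: with overwhelming probability, if there is a safety violation, then at
least `f` adversarial validators become slashable in the view of all clients, and no honest one in
the view of any client. The number of corruptions is not restricted. -/
def SlashableSafety (f : ℕ) : Prop :=
  ∀ A : Attacker, A.IsPPT P →
    Negligible fun κ => prob {ω : Coins P A κ |
      (final P A κ ω).ViolatedBy (A.slots.eval κ) ∧ ¬ RightlySlashable P A κ ω f}

/-- `f`-`T`-liveness: `T`-liveness holds with overwhelming probability if at most `f` nodes are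
corrupted. -/
def Liveness (f : ℕ) (T : ℕ → ℕ) : Prop :=
  ∀ A : Attacker, A.IsPPT P → (∀ κ, A.corruptions P κ ≤ f) →
    Negligible fun κ => prob {ω : Coins P A κ | ¬ LiveWithin P A κ ω (T κ)}

end Protocol

end PoS

/-!
The proof is an attack that works against every protocol, whatever its forensic procedure does. Let
`n` be the committee size.

*The honest execution.* The environment `env` corrupts nobody and delays nothing. In every slot it
inputs a random payload transaction to the initial validators; from slot `a` on it tells all of them
to withdraw, and `n` candidates to stake. Client `0` comes online in slot `a`, and client `1` in the
last slot, `a + b`. If `a` and `b` are large enough then, with overwhelming probability, liveness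
puts the first payload into the chains of both clients (`payload_mem_of_live`), and liveness and the
bound on the withdrawal delay together let the initial validators have withdrawn in the view of
client `1` (`released_of_live`). By `Protocol.Efficient`, everybody's running time is polynomial
(`exists_time_env_le`).

*The attack.* The attacker `attack` corrupts the `n` initial validators and runs two copies of the
honest execution with independent payloads. In copy `0` it plays the initial validators towards the
honest candidates and client `1`; copy `1` stops in slot `a`, before a candidate is involved, and is
shown to client `0` only. Both copies are uniformly distributed (`prob_simCoins`), and the clients
see exactly what they would see there (`AttackInvariant`). The chain of each client contains the
payload of its own copy, but that of the other copy only with negligible probability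
(`prob_payload_mem_le`), so safety is violated (`violated_attack`). The adversarial nodes are the
initial validators, and none of them is ever slashable in the view of client `1`: they have
withdrawn when this client comes online (`not_rightlySlashable_attack`). This contradicts slashable
safety.

Much of the work is to write the attacker as a program, to follow the two copies through the slots,
and to bound its running time: an execution of the code of a validator costs the attacker as much as
it costs the validator in the honest execution, and the rest is polynomial in the size of the data.
-/

namespace PoS

/-! ### Trees as lists, and programs assembled from lists of programs -/

namespace Data

@[simp] theorem toList_leaf : leaf.toList = [] := rfl
@[simp] theorem toList_node (a b : Data) : (node a b).toList = a :: b.toList := rfl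

@[simp] theorem toList_ofList (l : List Data) : (ofList l).toList = l := by
  induction l with
  | nil => rfl
  | cons a l ih => simp [ofList, ih]

@[simp] theorem ofList_nil : ofList [] = leaf := rfl
@[simp] theorem ofList_cons (a : Data) (l : List Data) : ofList (a :: l) = node a (ofList l) := rfl
@[simp] theorem fst_leaf : leaf.fst = leaf := rfl
@[simp] theorem snd_leaf : leaf.snd = leaf := rfl
@[simp] theorem fst_node (a b : Data) : (node a b).fst = a := rfl
@[simp] theorem snd_node (a b : Data) : (node a b).snd = b := rfl
@[simp] theorem flag_leaf : leaf.flag = false := rfl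
@[simp] theorem flag_node (a b : Data) : (node a b).flag = true := rfl
@[simp] theorem len_leaf : leaf.len = 0 := rfl
@[simp] theorem len_node (a b : Data) : (node a b).len = b.len + 1 := rfl
@[simp] theorem nth_leaf (i : ℕ) : leaf.nth i = leaf := rfl
@[simp] theorem nth_node_zero (a b : Data) : (node a b).nth 0 = a := rfl
@[simp] theorem nth_node_succ (a b : Data) (i : ℕ) : (node a b).nth (i + 1) = b.nth i := by
  simp [nth]
@[simp] theorem nth_node_one (a b : Data) : (node a b).nth 1 = b.nth 0 := nth_node_succ a b 0
@[simp] theorem nth_node_ofNat (a b : Data) (i : ℕ) [(i + 1).AtLeastTwo] :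
    (node a b).nth (OfNat.ofNat (i + 1)) = b.nth i := nth_node_succ a b i

@[simp] theorem len_ofNat (k : ℕ) : (ofNat k).len = k := by simp [len, ofNat]
@[simp] theorem len_ofBits {k : ℕ} (c : Fin k → Bool) : (ofBits c).len = k := by
  simp [len, ofBits]
@[simp] theorem flag_ofBool (b : Bool) : (ofBool b).flag = b := by cases b <;> rfl

theorem ofBool_injective : Function.Injective ofBool := by
  rintro (_ | _) (_ | _) h <;> first | rfl | cases h

theorem ofBits_injective {k : ℕ} : Function.Injective (ofBits (k := k)) := by
  intro c d h
  have := congrArg toList h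
  simp only [ofBits, toList_ofList] at this
  funext j
  exact ofBool_injective (congrFun (List.ofFn_injective this) j)

theorem nth_ofList_map_range (f : ℕ → Data) (k i : ℕ) :
    (ofList ((List.range k).map f)).nth i = if i < k then f i else leaf := by
  unfold nth
  split_ifs with h <;> simp [List.getD, h]

theorem nth_ofList_ofFn {k : ℕ} (f : Fin k → Data) {i : ℕ} (h : i < k) :
    (ofList (List.ofFn f)).nth i = f ⟨i, h⟩ := by
  simp [nth, List.getD, h]

theorem nth_eq_fst_iterate (d : Data) (i : ℕ) : d.nth i = (snd^[i] d).fst := by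
  induction i generalizing d with
  | zero => cases d <;> rfl
  | succ i ih =>
    rw [Function.iterate_succ_apply]
    cases d with
    | leaf => simpa using ih leaf
    | node a b => simpa using ih b

theorem flag_iterate_snd (d : Data) (i : ℕ) : (snd^[i] d).flag = decide (i < d.len) := by
  induction i generalizing d with
  | zero => cases d <;> simp
  | succ i ih =>
    rw [Function.iterate_succ_apply]
    cases d with
    | leaf => simpa using ih leaf
    | node a b => simp [ih]

theorem size_fst_le (d : Data) : d.fst.size ≤ d.size := by
  cases d <;> simp [size]; omega

theorem size_snd_le (d : Data) : d.snd.size ≤ d.size := by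
  cases d <;> simp [size]

theorem size_iterate_snd_le (d : Data) (i : ℕ) : (snd^[i] d).size ≤ d.size := by
  induction i generalizing d with
  | zero => exact le_rfl
  | succ i ih => exact (ih d.snd).trans d.size_snd_le

theorem size_nth_le (d : Data) (i : ℕ) : (d.nth i).size ≤ d.size := by
  rw [nth_eq_fst_iterate]
  exact (size_fst_le _).trans (size_iterate_snd_le _ _)

theorem size_ofList (l : List Data) : (ofList l).size = 1 + (l.map fun d => 1 + d.size).sum := by
  induction l with
  | nil => rfl
  | cons a l ih => simp [size, ih]; ring

theorem len_le_size (d : Data) : d.len ≤ d.size := by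
  induction d with
  | leaf => simp
  | node a b _ ih => simp [size]; omega

theorem size_ofList_le {l : List Data} {k : ℕ} (h : ∀ d ∈ l, d.size ≤ k) :
    (ofList l).size ≤ 1 + l.length * (1 + k) := by
  rw [size_ofList]
  have := List.sum_le_card_nsmul (l.map fun d => 1 + d.size) (1 + k) (by simpa using h)
  simpa using this

theorem size_ofNat_le (k : ℕ) : (ofNat k).size ≤ 1 + k * 2 := by
  refine (size_ofList_le (k := 1) ?_).trans (by simp)
  intro d hd
  rw [List.eq_of_mem_replicate hd]; rfl

theorem size_ofBits_le {k : ℕ} (c : Fin k → Bool) : (ofBits c).size ≤ 1 + k * 4 := by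
  refine (size_ofList_le (k := 3) ?_).trans (by simp)
  simp only [List.mem_ofFn, forall_exists_index, forall_apply_eq_imp_iff]
  intro j
  cases c j <;> simp [ofBool, size]

/-- A tree read as a list of blocks contains fewer transactions than it has vertices. -/
theorem length_txs_lt_size (d : Data) : (Chain.txs d.toList).length < d.size := by
  induction d with
  | leaf => simp [Chain.txs, size]
  | node a b _ ih =>
    have h := a.len_le_size
    simp only [Chain.txs, len, toList_node, List.flatMap_cons, List.length_append, size] at *
    omega

end Data

namespace Prog

/-- The projection to the `i`-th entry of a list. -/
def arg : ℕ → Prog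
  | 0 => fst
  | i + 1 => comp (arg i) snd

/-- The list of the outputs of several programs. -/
def list : List Prog → Prog
  | [] => nil
  | p :: l => pair p (list l)

/-- The program with a constant output. -/
def const : Data → Prog
  | .leaf => nil
  | .node a b => pair (const a) (const b)

@[simp] theorem eval_arg (i : ℕ) (x : Data) : (arg i).eval x = x.nth i := by
  induction i generalizing x with
  | zero => cases x <;> rfl
  | succ i ih => cases x <;> simp [arg, eval, ih]

@[simp] theorem eval_list (l : List Prog) (x : Data) :
    (list l).eval x = .ofList (l.map fun p => p.eval x) := by
  induction l with
  | nil => rfl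
  | cons p l ih => simp [list, eval, ih]

@[simp] theorem eval_const (d x : Data) : (const d).eval x = d := by
  induction d with
  | leaf => rfl
  | node a b ha hb => simp [const, eval, ha, hb]

/-- A program has to read its input, so a bound on its running time is one on the input, too. -/
theorem lt_cost (p : Prog) (x : Data) : x.size < p.cost x := by
  induction p generalizing x with
  | id => simp [cost]
  | nil => simp [cost]
  | fst => simp [cost]
  | snd => simp [cost]
  | pair p q hp hq => have := hp x; simp only [cost]; omega
  | comp p q hp hq => have := hq x; simp only [cost]; omega
  | ite c p q hc hp hq => have := hc x; simp only [cost]; omega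
  | loop p hp => simp only [cost]; omega

/-- No tree can be produced faster than it can be written down. -/
theorem size_eval_le_cost (p : Prog) (x : Data) : (p.eval x).size ≤ p.cost x := by
  induction p generalizing x with
  | id => simp [cost, eval]
  | nil => simp [cost, eval, Data.size]
  | fst => have := x.size_fst_le; simp only [cost, eval]; omega
  | snd => have := x.size_snd_le; simp only [cost, eval]; omega
  | pair p q hp hq => have := hp x; have := hq x; simp only [cost, eval, Data.size]; omega
  | comp p q hp hq => have := hp (q.eval x); simp only [cost, eval]; omega
  | ite c p q hc hp hq =>
    have := hp x; have := hq x; simp only [cost, eval]; split_ifs <;> omega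
  | loop p hp =>
    simp only [cost, eval]
    rcases x.fst.len with _ | k
    · have := x.size_snd_le; simp; omega
    · rw [Finset.sum_range_succ, Function.iterate_succ_apply']
      have := hp (p.eval^[k] x.snd)
      omega

end Prog


/-! ### Polynomial bounds -/

theorem eval_le_eval (p : Polynomial ℕ) {a b : ℕ} (h : a ≤ b) : p.eval a ≤ p.eval b := by
  simp only [Polynomial.eval_eq_sum_range]
  gcongr

namespace PolyBounded

theorem of_le {f g : ℕ → ℕ} (hg : PolyBounded g) (h : ∀ κ, f κ ≤ g κ) : PolyBounded f :=
  hg.imp fun _ hp κ => (h κ).trans (hp κ)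

theorem eval (p : Polynomial ℕ) : PolyBounded fun κ => p.eval κ := ⟨p, fun _ => le_rfl⟩

theorem const (k : ℕ) : PolyBounded fun _ => k := ⟨Polynomial.C k, fun _ => by simp⟩

theorem self : PolyBounded fun κ => κ := ⟨Polynomial.X, fun _ => by simp⟩

theorem add {f g : ℕ → ℕ} (hf : PolyBounded f) (hg : PolyBounded g) :
    PolyBounded fun κ => f κ + g κ := by
  obtain ⟨p, hp⟩ := hf
  obtain ⟨q, hq⟩ := hg
  exact ⟨p + q, fun κ => by simpa using Nat.add_le_add (hp κ) (hq κ)⟩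

theorem mul {f g : ℕ → ℕ} (hf : PolyBounded f) (hg : PolyBounded g) :
    PolyBounded fun κ => f κ * g κ := by
  obtain ⟨p, hp⟩ := hf
  obtain ⟨q, hq⟩ := hg
  exact ⟨p * q, fun κ => by simpa using Nat.mul_le_mul (hp κ) (hq κ)⟩

theorem eval_comp (p : Polynomial ℕ) {f : ℕ → ℕ} (hf : PolyBounded f) :
    PolyBounded fun κ => p.eval (f κ) := by
  obtain ⟨q, hq⟩ := hf
  exact ⟨p.comp q, fun κ => by simpa using eval_le_eval p (hq κ)⟩

end PolyBounded

namespace Prog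

/-- The running time of the program is polynomial in the size of its input. -/
def IsPoly (p : Prog) : Prop := ∃ f : Polynomial ℕ, ∀ x, p.cost x ≤ f.eval x.size

namespace IsPoly

theorem nil : IsPoly .nil := ⟨1 + .X, fun x => by simp [cost]⟩
theorem id : IsPoly .id := ⟨1 + .X, fun x => by simp [cost]⟩
theorem fst : IsPoly .fst := ⟨1 + .X, fun x => by simp [cost]⟩
theorem snd : IsPoly .snd := ⟨1 + .X, fun x => by simp [cost]⟩

theorem pair {p q : Prog} (hp : p.IsPoly) (hq : q.IsPoly) : IsPoly (.pair p q) := by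
  obtain ⟨f, hf⟩ := hp
  obtain ⟨g, hg⟩ := hq
  refine ⟨1 + f + g, fun x => ?_⟩
  have := hf x
  have := hg x
  simp [cost]; omega

theorem comp {p q : Prog} (hp : p.IsPoly) (hq : q.IsPoly) : IsPoly (.comp p q) := by
  obtain ⟨f, hf⟩ := hp
  obtain ⟨g, hg⟩ := hq
  refine ⟨1 + g + f.comp g, fun x => ?_⟩
  have := hg x
  have h := (hf (q.eval x)).trans (eval_le_eval f ((q.size_eval_le_cost x).trans (hg x)))
  simp only [cost, Polynomial.eval_add, Polynomial.eval_one, Polynomial.eval_comp] at h ⊢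
  omega

theorem ite {c p q : Prog} (hc : c.IsPoly) (hp : p.IsPoly) (hq : q.IsPoly) :
    IsPoly (.ite c p q) := by
  obtain ⟨e, he⟩ := hc
  obtain ⟨f, hf⟩ := hp
  obtain ⟨g, hg⟩ := hq
  refine ⟨1 + e + f + g, fun x => ?_⟩
  have := he x
  have := hf x
  have := hg x
  simp only [cost, Polynomial.eval_add, Polynomial.eval_one]
  split_ifs <;> omega

theorem loop_snd : IsPoly (.loop .snd) := by
  refine ⟨1 + .X + .X * (1 + .X), fun x => ?_⟩
  have h : ∀ t ∈ Finset.range x.fst.len, Prog.snd.cost (Prog.snd.eval^[t] x.snd) ≤ 1 + x.size :=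
    fun t _ => Nat.add_le_add_left ((Data.size_iterate_snd_le _ t).trans x.size_snd_le) 1
  have h1 := Finset.sum_le_card_nsmul _ _ _ h
  have h2 := (x.fst.len_le_size).trans x.size_fst_le
  simp only [Finset.card_range, smul_eq_mul] at h1
  rw [cost]
  simp only [Polynomial.eval_add, Polynomial.eval_one, Polynomial.eval_X, Polynomial.eval_mul]
  exact Nat.add_le_add_left (h1.trans (Nat.mul_le_mul_right _ h2)) _

theorem arg (i : ℕ) : IsPoly (.arg i) := by
  induction i with
  | zero => exact fst
  | succ i ih => exact ih.comp snd

theorem list {l : List Prog} (h : ∀ p ∈ l, p.IsPoly) : IsPoly (.list l) := by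
  induction l with
  | nil => exact nil
  | cons p l ih =>
    exact (h p (by simp)).pair (ih fun q hq => h q (by simp [hq]))

theorem const (d : Data) : IsPoly (.const d) := by
  induction d with
  | leaf => exact nil
  | node a b ha hb => exact ha.pair hb

end IsPoly

end Prog

/-! ### Negligible functions and counting -/

namespace Negligible

theorem add {f g : ℕ → ℝ} (hf : Negligible f) (hg : Negligible g) :
    Negligible fun κ => f κ + g κ :=
  Asymptotics.SuperpolynomialDecay.add hf hg

theorem of_le {f g : ℕ → ℝ} (hg : Negligible g) (hf : ∀ κ, 0 ≤ f κ) (h : ∀ κ, f κ ≤ g κ) :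
    Negligible f :=
  Asymptotics.SuperpolynomialDecay.trans_abs_le hg fun κ => by
    simpa [abs_of_nonneg (hf κ)] using (h κ).trans (le_abs_self _)

theorem polyBounded_div_two_pow {B : ℕ → ℕ} (hB : PolyBounded B) :
    Negligible fun κ => (B κ : ℝ) / 2 ^ κ := by
  obtain ⟨p, hp⟩ := hB
  have h : Negligible fun κ => ((2 : ℝ) ^ κ)⁻¹ := fun k => by
    simpa [div_eq_mul_inv] using
      tendsto_pow_const_div_const_pow_of_one_lt k (one_lt_two : (1 : ℝ) < 2)
  have h' := Asymptotics.SuperpolynomialDecay.polynomial_mul h (p.map (Nat.castRingHom ℝ))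
  refine of_le h' (fun κ => by positivity) fun κ => ?_
  have : ((p.map (Nat.castRingHom ℝ)).eval (κ : ℝ)) = (p.eval κ : ℕ) := by
    rw [Polynomial.eval_map, Polynomial.eval₂_at_natCast]; simp
  rw [this, div_eq_mul_inv]
  gcongr
  exact hp κ

theorem exists_lt_one {f : ℕ → ℝ} (hf : Negligible f) : ∃ κ, f κ < 1 := by
  have h := hf 0
  simp only [pow_zero, one_mul] at h
  exact (h.eventually (gt_mem_nhds one_pos)).exists

end Negligible

section Prob

variable {Ω : Type}

theorem prob_mono [Finite Ω] {E F : Set Ω} (h : E ⊆ F) : prob E ≤ prob F := by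
  unfold prob
  have := Nat.card_mono (Set.toFinite F) h
  gcongr

theorem prob_union_le [Finite Ω] (E F : Set Ω) : prob (E ∪ F) ≤ prob E + prob F := by
  unfold prob
  rw [← add_div]
  have := Set.ncard_union_le E F
  simp only [← Nat.card_coe_set_eq] at this
  gcongr
  exact_mod_cast this

theorem prob_univ [Finite Ω] [Nonempty Ω] : prob (Set.univ : Set Ω) = 1 := by
  unfold prob
  rw [Nat.card_univ, div_self]
  exact_mod_cast Nat.card_pos.ne'

end Prob

/-- A coordinate `β` of a product space `α`: it can be read, and it can be overwritten without
touching the rest. -/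
structure Coordinate (α β : Type) where
  get : α → β
  set : α → β → α
  get_set : ∀ a b, get (set a b) = b
  set_set : ∀ a b c, set (set a b) c = set a c
  set_get : ∀ a, set a (get a) = a

namespace Coordinate

variable {α β : Type} (l : Coordinate α β)

/-- The coordinate is exchanged with an independent copy of it. -/
def swap : α × β ≃ α × β where
  toFun x := (l.set x.1 x.2, l.get x.1)
  invFun x := (l.set x.1 x.2, l.get x.1)
  left_inv x := by simp [l.get_set, l.set_set, l.set_get]
  right_inv x := by simp [l.get_set, l.set_set, l.set_get]

/-- A relation that, apart from its second argument, does not involve the coordinate is met by the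
coordinate as often as by an independent copy. -/
theorem card_mul_card (R : α → β → Prop) (hR : ∀ a b c, R (l.set a b) c ↔ R a c) :
    Nat.card {a | R a (l.get a)} * Nat.card β = Nat.card {x : α × β | R x.1 x.2} := by
  rw [← Nat.card_prod]
  refine Nat.card_congr
    ((Equiv.prodSubtypeFstEquivSubtypeProd (p := fun a => R a (l.get a))).symm.trans
      (l.swap.subtypeEquiv fun x => ?_))
  exact (hR x.1 x.2 (l.get x.1)).symm

theorem prob_preimage [Finite α] [Finite β] [Nonempty α] (E : Set β) :
    prob (l.get ⁻¹' E) = prob E := by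
  have : Nonempty β := ⟨l.get (Classical.arbitrary α)⟩
  have h := l.card_mul_card (fun _ b => b ∈ E) (fun _ _ _ => Iff.rfl)
  have h2 : Nat.card {x : α × β | x.2 ∈ E} = Nat.card α * Nat.card E := by
    rw [← Nat.card_prod]
    exact Nat.card_congr
      ⟨fun x => (x.1.1, ⟨x.1.2, x.2⟩), fun x => ⟨(x.1, x.2.1), x.2.2⟩, fun _ => rfl, fun _ => rfl⟩
  rw [h2] at h
  have hα : (Nat.card α : ℝ) ≠ 0 := by exact_mod_cast Nat.card_pos.ne'
  have hβ : (Nat.card β : ℝ) ≠ 0 := by exact_mod_cast Nat.card_pos.ne'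
  unfold prob
  rw [div_eq_div_iff hα hβ]
  have h' : ((Nat.card (l.get ⁻¹' E) * Nat.card β : ℕ) : ℝ) = (Nat.card α * Nat.card E : ℕ) :=
    congrArg Nat.cast h
  push_cast at h'
  linarith

/-- Few values are hit with small probability only, if they are chosen without regard to the
coordinate. -/
theorem prob_get_mem_le [Finite α] [Finite β] [Nonempty α] (S : α → Set β) (k : ℕ)
    (hS : ∀ a b, S (l.set a b) = S a) (hk : ∀ a, (S a).ncard ≤ k) :
    prob {a | l.get a ∈ S a} ≤ k / Nat.card β := by
  have : Nonempty β := ⟨l.get (Classical.arbitrary α)⟩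
  have h := l.card_mul_card (fun a b => b ∈ S a) (fun a b c => by rw [hS])
  have h2 : Nat.card {x : α × β | x.2 ∈ S x.1} ≤ Nat.card α * k := by
    have := Fintype.ofFinite α
    rw [Nat.card_congr (β := Σ a, S a)
      ⟨fun x => ⟨x.1.1, x.1.2, x.2⟩, fun x => ⟨(x.1, x.2.1), x.2.2⟩, fun _ => rfl, fun _ => rfl⟩,
      Nat.card_sigma, Nat.card_eq_fintype_card]
    simpa using Finset.sum_le_card_nsmul Finset.univ _ k fun a _ => hk a
  have hα : (0 : ℝ) < Nat.card α := by exact_mod_cast Nat.card_pos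
  have hβ : (0 : ℝ) < Nat.card β := by exact_mod_cast Nat.card_pos
  unfold prob
  rw [div_le_div_iff₀ hα hβ, mul_comm (k : ℝ)]
  exact_mod_cast h.trans_le h2

end Coordinate


/-! ### Executions -/

section Execution

variable (P : Protocol) (A : Attacker) (κ : ℕ) (ω : Coins P A κ)

@[simp] theorem session_prot : (session P A κ ω).prot = P := rfl
@[simp] theorem session_att : (session P A κ ω).att = A := rfl
@[simp] theorem session_κ : (session P A κ ω).κ = κ := rfl

theorem worldAt_zero : worldAt P A κ ω 0 = (session P A κ ω).init := rfl

theorem worldAt_succ {r : ℕ} (h : r < A.slots.eval κ) :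
    worldAt P A κ ω (r + 1) =
      (session P A κ ω).next r (worldAt P A κ ω r) (partyCoins P A κ ω ⟨r, h⟩)
        (attackerCoins P A κ ω ⟨r, h⟩) := by
  rw [worldAt, dif_pos h]

theorem worldAt_of_le {r : ℕ} (h : A.slots.eval κ ≤ r) :
    worldAt P A κ ω r = final P A κ ω := by
  induction r, h using Nat.le_induction with
  | base => rfl
  | succ r hr ih => rw [worldAt, dif_neg hr.not_gt, ih]

/-- A property of worlds that holds initially and is preserved by every slot of the execution holds
throughout. -/
theorem worldAt_induction {p : ℕ → World → Prop} (h0 : p 0 (session P A κ ω).init)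
    (hs : ∀ r (h : r < A.slots.eval κ), p r (worldAt P A κ ω r) → p (r + 1)
      ((session P A κ ω).next r (worldAt P A κ ω r) (partyCoins P A κ ω ⟨r, h⟩)
        (attackerCoins P A κ ω ⟨r, h⟩)))
    {r : ℕ} (hr : r ≤ A.slots.eval κ) : p r (worldAt P A κ ω r) := by
  induction r with
  | zero => exact h0
  | succ r ih => rw [worldAt_succ P A κ ω hr]; exact hs r hr (ih (Nat.le_of_succ_le hr))

/-- A quantity that does not decrease in any slot is monotone in time. -/
theorem worldAt_mono {α : Type*} [Preorder α] (f : World → α)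
    (h : ∀ r w coins advCoins, f w ≤ f ((session P A κ ω).next r w coins advCoins)) :
    Monotone fun r => f (worldAt P A κ ω r) := by
  refine monotone_nat_of_le_succ fun r => ?_
  by_cases hr : r < A.slots.eval κ
  · rw [worldAt_succ P A κ ω hr]; exact h _ _ _ _
  · simp only [worldAt, dif_neg hr, le_refl]

end Execution

namespace Session

variable (s : Session) (r : ℕ) (w : World) (coins : Party → Data) (advCoins : Data)

theorem log_subset_next (p : Party) :
    {e | e ∈ (w.loc p).log} ⊆ {e | e ∈ ((s.next r w coins advCoins).loc p).log} := by
  intro e he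
  rw [Set.mem_ofPred_eq] at he ⊢
  cases p <;> simp only [next] <;> split_ifs <;>
    first
    | exact he
    | (simp only [stepLocal]; split_ifs <;> simp [he])

theorem submitted_subset_next :
    {m | m ∈ w.submitted} ⊆ {m | m ∈ (s.next r w coins advCoins).submitted} := by
  intro m hm
  rw [Set.mem_ofPred_eq] at hm ⊢
  exact List.mem_append_right _ hm

@[simp] theorem next_joined (i : ℕ) :
    ((s.next r w coins advCoins).info i).joined =
      joined w (s.att.step.eval (s.advInput r w advCoins)) i := by
  simp only [next]; split_ifs <;> rfl

@[simp] theorem next_seized (i : ℕ) :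
    ((s.next r w coins advCoins).info i).seized =
      seized w (s.att.step.eval (s.advInput r w advCoins)) i := by
  simp only [next]; split_ifs <;> rfl

@[simp] theorem advInput_pks : (s.advInput r w advCoins).nth 1 = s.pks := by simp [advInput]
@[simp] theorem advInput_secrets : (s.advInput r w advCoins).nth 2 =
    s.perNode fun i => if s.corrupt i then (s.key i).snd else .leaf := by simp [advInput]
@[simp] theorem advInput_slot : (s.advInput r w advCoins).nth 3 = .ofNat r := by simp [advInput]
@[simp] theorem advInput_state : (s.advInput r w advCoins).nth 4 = w.advState := by
  simp [advInput]
@[simp] theorem advInput_messages : (s.advInput r w advCoins).nth 5 =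
    s.perNode fun i => .ofList (((w.info i).sent.filter fun m => m.1 + 1 = r).map Prod.snd) := by
  simp [advInput]
@[simp] theorem advInput_coins : (s.advInput r w advCoins).nth 7 = advCoins := by simp [advInput]
@[simp] theorem advInput_param : (s.advInput r w advCoins).nth 0 = .ofNat s.κ := by
  simp [advInput]

/-- The messages of a node are paid for by its running time. -/
theorem sent_size_next (i : ℕ)
    (h : ((w.info i).sent.map fun m => 1 + m.2.size).sum ≤ 2 * (w.loc (.node i)).time) :
    (((s.next r w coins advCoins).info i).sent.map fun m => 1 + m.2.size).sum ≤
      2 * ((s.next r w coins advCoins).loc (.node i)).time := by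
  simp only [next]
  split_ifs with hr
  · simp only [stepInfo, stepLocal, List.map_cons, List.sum_cons, stepOutput]
    generalize s.stepInput r w _ (coins (.node i)) (.node i) = x
    have h1 := (Data.size_nth_le (s.prot.step.eval x) 1).trans (s.prot.step.size_eval_le_cost x)
    have h2 := s.prot.step.lt_cost x
    omega
  · exact h

end Session

section Execution

variable (P : Protocol) (A : Attacker) (κ : ℕ) (ω : Coins P A κ)

theorem mem_log_final {p : Party} {e : Entry} {r : ℕ} (h : e ∈ ((worldAt P A κ ω r).loc p).log) :
    e ∈ ((final P A κ ω).loc p).log := by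
  have := worldAt_mono P A κ ω (fun w => {e | e ∈ (w.loc p).log})
    fun _ _ _ _ => Session.log_subset_next _ _ _ _ _ _
  rw [← worldAt_of_le P A κ ω (le_max_left _ r)]
  exact this (le_max_right _ r) h

theorem mem_submitted_final {m : ℕ × Data} {r : ℕ}
    (h : m ∈ (worldAt P A κ ω r).submitted) : m ∈ (final P A κ ω).submitted := by
  have := worldAt_mono P A κ ω (fun w => {m | m ∈ w.submitted})
    fun _ _ _ _ => Session.submitted_subset_next _ _ _ _ _
  rw [← worldAt_of_le P A κ ω (le_max_left _ r)]
  exact this (le_max_right _ r) h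

theorem sent_size_le (i r : ℕ) :
    (((worldAt P A κ ω r).info i).sent.map fun m => 1 + m.2.size).sum ≤
      2 * ((worldAt P A κ ω r).loc (.node i)).time := by
  induction r with
  | zero => simp [worldAt_zero, Session.init]
  | succ r ih =>
    by_cases hr : r < A.slots.eval κ
    · rw [worldAt_succ P A κ ω hr]; exact Session.sent_size_next _ _ _ _ _ _ ih
    · simpa only [worldAt, dif_neg hr] using ih

/-- The messages of the previous slot, as they are handed to the attacker. -/
theorem size_messages_le (i r : ℕ) :
    (Data.ofList ((((worldAt P A κ ω r).info i).sent.filter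
      fun m => m.1 + 1 = r).map Prod.snd)).size ≤
      1 + 2 * ((worldAt P A κ ω r).loc (.node i)).time := by
  refine le_trans ?_ (Nat.add_le_add_left (sent_size_le P A κ ω i r) 1)
  rw [Data.size_ofList, List.map_map]
  refine Nat.add_le_add_left ?_ 1
  exact List.Sublist.sum_le_sum (List.Sublist.map _ List.filter_sublist) (fun _ _ => Nat.zero_le _)

/-- The running time of the attacker is the sum of its costs in the single slots. -/
theorem advTime_eq {r : ℕ} (hr : r ≤ A.slots.eval κ) :
    (worldAt P A κ ω r).advTime = A.corrupt.cost (.ofNat κ) +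
      ∑ t : Fin r, A.step.cost ((session P A κ ω).advInput t (worldAt P A κ ω t)
        (attackerCoins P A κ ω ⟨t, t.2.trans_le hr⟩)) := by
  induction r with
  | zero => simp [worldAt_zero, Session.init]
  | succ r ih =>
    rw [worldAt_succ P A κ ω hr, Fin.sum_univ_castSucc, ← add_assoc, Session.next]
    simp only [ih (Nat.le_of_succ_le hr)]
    rfl

theorem isPPT_of_cost_le {f : ℕ → ℕ} (hf : PolyBounded f)
    (h : ∀ κ ω r (hr : r < A.slots.eval κ), A.step.cost ((session P A κ ω).advInput r
      (worldAt P A κ ω r) (attackerCoins P A κ ω ⟨r, hr⟩)) ≤ f κ)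
    (hc : A.corrupt.IsPoly) : A.IsPPT P := by
  obtain ⟨c, hc⟩ := hc
  obtain ⟨q, hq⟩ : PolyBounded fun κ => c.eval (1 + κ * 2) + A.slots.eval κ * f κ :=
    (PolyBounded.eval_comp c
      ((PolyBounded.const 1).add (PolyBounded.self.mul (.const 2)))).add ((PolyBounded.eval _).mul hf)
  refine ⟨q, fun κ ω => le_trans ?_ (hq κ)⟩
  beta_reduce
  rw [final, advTime_eq P A κ ω le_rfl]
  refine Nat.add_le_add ((hc _).trans (eval_le_eval c (Data.size_ofNat_le κ))) ?_
  calc _ ≤ ∑ _t : Fin (A.slots.eval κ), f κ := Finset.sum_le_sum fun t _ => h κ ω t t.2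
    _ = _ := by simp

end Execution


/-! ### The environment of an honest execution -/

namespace Prog

/-- The flag that tells whether the slot, entry `3` of the input, has reached the length of the
output of a program. -/
def due (timer : Prog) : Prog :=
  .ite (.comp (.loop .snd) (.pair (.arg 3) timer)) .nil (.const (.ofBool true))

/-- Entry `k` of the coins, which are entry `7` of the input of an attacker. -/
def coin (k : ℕ) : Prog := .comp (.arg k) (.arg 7)

theorem eval_due (timer : Prog) (x : Data) :
    (due timer).eval x = .ofBool (decide ((timer.eval x).len ≤ (x.nth 3).len)) := by
  have : ∀ y : Data, Prog.snd.eval y = y.snd := fun _ => rfl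
  have h : ((Prog.loop .snd).eval (.node (x.nth 3) (timer.eval x))).flag =
      decide ((x.nth 3).len < (timer.eval x).len) := by
    rw [← Data.flag_iterate_snd]; rfl
  simp only [due, eval, eval_arg, eval_const] at h ⊢
  rw [h]
  by_cases h' : (x.nth 3).len < (timer.eval x).len
  · simp [h', Nat.not_le.2 h', Data.ofBool]
  · simp [h', not_lt.1 h']

@[simp] theorem eval_coin (k : ℕ) (x : Data) : (coin k).eval x = (x.nth 7).nth k := by
  simp [coin, eval]

theorem IsPoly.due {timer : Prog} (h : timer.IsPoly) : IsPoly (.due timer) :=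
  .ite (loop_snd.comp (.pair (.arg 3) h)) .nil (.const _)

theorem IsPoly.coin (k : ℕ) : IsPoly (.coin k) := .comp (.arg k) (.arg 7)

end Prog

/-- The lengths of the random strings that the environment uses in a slot. The first two serve as
timers, and only their lengths matter; the third one is the payload of a transaction. -/
noncomputable def envBits (a b : Polynomial ℕ) : ℕ → Polynomial ℕ
  | 0 => a
  | 1 => a + b
  | _ + 2 => .X

/-- The environment of an execution without corruptions. In every slot, the initial validators get
a random payload transaction. From slot `a` on, they are told to withdraw, as many candidates are
told to stake, and client `0` is online. Client `1` is online in the last slot, `a + b`, only.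
There are no network delays. -/
noncomputable def env (P : Protocol) (a b : Polynomial ℕ) : Attacker where
  candidates := .C P.committee
  clients := .C 2
  slots := a + b + 1
  blocks := 3
  blockBits j := envBits a b j
  corrupt := .nil
  step := .list
    [.nil,
      .list ((List.range (P.committee + P.committee)).map fun i =>
        if i < P.committee then .list [.nil, .due (.coin 0), .list [.coin 2]]
        else .list [.due (.coin 0)]),
      .list [.list [.due (.coin 0)], .list [.due (.coin 1)]]]

section Env

variable (P : Protocol) (a b : Polynomial ℕ)

open Session

theorem nodeOrder_env (x : Data) (i : ℕ) :
    nodeOrder ((env P a b).step.eval x) i =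
      if i < P.committee + P.committee then
        if i < P.committee then
          .ofList [.leaf, .ofBool (decide (((x.nth 7).nth 0).len ≤ (x.nth 3).len)),
            .ofList [(x.nth 7).nth 2]]
        else .ofList [.ofBool (decide (((x.nth 7).nth 0).len ≤ (x.nth 3).len))]
      else .leaf := by
  have h : nodeOrder ((env P a b).step.eval x) i =
      (Data.ofList ((List.range (P.committee + P.committee)).map fun i =>
        Prog.eval (if i < P.committee then .list [.nil, .due (.coin 0), .list [.coin 2]]
          else .list [.due (.coin 0)]) x)).nth i := by
    simp [nodeOrder, env, Function.comp_def]
  rw [h, Data.nth_ofList_map_range]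
  split_ifs <;> simp [Prog.eval_due, Prog.eval]

theorem clientOrder_env_zero (x : Data) :
    clientOrder ((env P a b).step.eval x) 0 =
      .ofList [.ofBool (decide (((x.nth 7).nth 0).len ≤ (x.nth 3).len))] := by
  simp [clientOrder, env, Prog.eval_due]

theorem clientOrder_env_one (x : Data) :
    clientOrder ((env P a b).step.eval x) 1 =
      .ofList [.ofBool (decide (((x.nth 7).nth 1).len ≤ (x.nth 3).len))] := by
  simp [clientOrder, env, Prog.eval_due]

theorem isPoly_env_step : (env P a b).step.IsPoly := by
  have h : ∀ k, (Prog.due (.coin k)).IsPoly := fun k => .due (.coin k)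
  refine .list ?_
  simp only [List.mem_cons, List.not_mem_nil, or_false, forall_eq_or_imp, forall_eq]
  refine ⟨.nil, .list ?_, .list ?_⟩
  · simp only [List.mem_map, forall_exists_index, and_imp, forall_apply_eq_imp_iff₂]
    intro i _
    split_ifs
    · refine .list ?_
      simp only [List.mem_cons, List.not_mem_nil, or_false, forall_eq_or_imp, forall_eq]
      refine ⟨.nil, h 0, .list ?_⟩
      simpa using .coin 2
    · exact .list (by simpa using h 0)
  · simp only [List.mem_cons, List.not_mem_nil, or_false, forall_eq_or_imp, forall_eq]
    exact ⟨.list (by simpa using h 0), .list (by simpa using h 1)⟩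

variable {P a b} {κ : ℕ} (ω : Coins P (env P a b) κ)

theorem N_env : (session P (env P a b) κ ω).N = P.committee + P.committee := by
  change P.committee + (env P a b).candidates.eval κ = _
  simp [env]

theorem K_env : (session P (env P a b) κ ω).K = 2 := by
  change (env P a b).clients.eval κ = 2
  simp [env]

theorem corrupt_env (i : ℕ) : (session P (env P a b) κ ω).corrupt i = false := rfl

theorem eval_slots_env : (env P a b).slots.eval κ = a.eval κ + b.eval κ + 1 := by simp [env]

/-- The payload of the transactions of slot `r`. -/
noncomputable def payload (r : Fin ((env P a b).slots.eval κ)) : Data :=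
  .ofBits ((ω.2 r).2.2 ⟨2, (by decide : 2 < 3)⟩)

theorem nth_attackerCoins (A : Attacker) (ω : Coins P A κ) (r : Fin (A.slots.eval κ)) {k : ℕ}
    (hk : k < A.blocks) :
    (attackerCoins P A κ ω r).nth k = .ofBits ((ω.2 r).2.2 ⟨k, hk⟩) :=
  Data.nth_ofList_ofFn _ hk

theorem len_env_timer_zero (r : Fin ((env P a b).slots.eval κ)) :
    ((attackerCoins P _ κ ω r).nth 0).len = a.eval κ := by
  rw [nth_attackerCoins _ _ _ (show 0 < (env P a b).blocks from (by decide : 0 < 3)),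
    Data.len_ofBits]; rfl

theorem len_env_timer_one (r : Fin ((env P a b).slots.eval κ)) :
    ((attackerCoins P _ κ ω r).nth 1).len = a.eval κ + b.eval κ := by
  rw [nth_attackerCoins _ _ _ (show 1 < (env P a b).blocks from (by decide : 1 < 3)),
    Data.len_ofBits]
  exact Polynomial.eval_add

/-- The orders of the environment in slot `r`. -/
noncomputable def envOrders (r : Fin ((env P a b).slots.eval κ)) : Data :=
  (env P a b).step.eval ((session P (env P a b) κ ω).advInput r (worldAt P (env P a b) κ ω r)
    (attackerCoins P (env P a b) κ ω r))

variable (r : Fin ((env P a b).slots.eval κ))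

theorem nodeOrder_envOrders (i : ℕ) : nodeOrder (envOrders ω r) i =
    if i < P.committee + P.committee then
      if i < P.committee then
        .ofList [.leaf, .ofBool (decide (a.eval κ ≤ r)), .ofList [payload ω r]]
      else .ofList [.ofBool (decide (a.eval κ ≤ r))]
    else .leaf := by
  rw [envOrders, nodeOrder_env, advInput_coins, len_env_timer_zero, advInput_slot, Data.len_ofNat,
    nth_attackerCoins _ _ _ (show 2 < (env P a b).blocks from (by decide : 2 < 3))]
  rfl

theorem clientOrder_envOrders_zero : clientOrder (envOrders ω r) 0 =
    .ofList [.ofBool (decide (a.eval κ ≤ r))] := by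
  rw [envOrders, clientOrder_env_zero, advInput_coins, len_env_timer_zero, advInput_slot,
    Data.len_ofNat]

theorem clientOrder_envOrders_one : clientOrder (envOrders ω r) 1 =
    .ofList [.ofBool (decide (a.eval κ + b.eval κ ≤ r))] := by
  rw [envOrders, clientOrder_env_one, advInput_coins, len_env_timer_one, advInput_slot,
    Data.len_ofNat]

theorem worldAt_env_succ : worldAt P (env P a b) κ ω (r + 1) =
    (session P (env P a b) κ ω).next r (worldAt P (env P a b) κ ω r)
      (partyCoins P (env P a b) κ ω r) (attackerCoins P (env P a b) κ ω r) :=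
  worldAt_succ P _ κ ω r.2

theorem joined_envOrders (w : World) (i : ℕ) : joined w (envOrders ω r) i =
    ((w.info i).joined || decide (P.committee ≤ i ∧ i < P.committee + P.committee ∧
      a.eval κ ≤ r)) := by
  rw [joined, nodeOrder_envOrders]
  by_cases h1 : i < P.committee + P.committee <;> by_cases h2 : i < P.committee <;>
    simp [h1, h2, Nat.not_le.2, Nat.not_lt.1]

theorem seized_envOrders (w : World) (i : ℕ) :
    seized w (envOrders ω r) i = (w.info i).seized := by
  rw [seized, nodeOrder_envOrders]
  split_ifs <;> simp

theorem asked_envOrders (i : ℕ) : ((nodeOrder (envOrders ω r) i).nth 1).flag =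
    decide (i < P.committee ∧ a.eval κ ≤ r) := by
  rw [nodeOrder_envOrders]
  by_cases h1 : i < P.committee + P.committee <;> by_cases h2 : i < P.committee <;>
    simp [h1, h2]
  omega

theorem netOrder_envOrders (p : Party) (j : ℕ) :
    (netOrder (envOrders ω r) p).nth j = .leaf := by
  rcases p with i | _ | _ | q
  · rw [netOrder, nodeOrder_envOrders]
    split_ifs <;> simp
  · rw [netOrder, clientOrder_envOrders_zero]; simp
  · rw [netOrder, clientOrder_envOrders_one]; simp
  · simp [netOrder, clientOrder, envOrders, env]

theorem inputs_envOrders (i : ℕ) : inputs (envOrders ω r) (.node i) =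
    if i < P.committee then
      (if a.eval κ ≤ r then [withdrawTx i] else []) ++ [payTx (payload ω r)]
    else if i < P.committee + P.committee ∧ a.eval κ ≤ r then [stakeTx i] else [] := by
  rw [inputs, tasks, nodeOrder_envOrders]
  by_cases h1 : i < P.committee + P.committee <;> by_cases h2 : i < P.committee <;>
    simp [h1, h2]
  omega

/-- The course of the honest execution, up to slot `r`. -/
structure EnvInvariant (P : Protocol) (a b : Polynomial ℕ) (κ r : ℕ) (w : World) : Prop where
  seized : ∀ i, (w.info i).seized = false
  joined : ∀ i, (w.info i).joined =
    decide (i < P.committee ∨ i < P.committee + P.committee ∧ a.eval κ < r)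
  asked : ∀ i, (w.info i).asked = decide (i < P.committee ∧ a.eval κ < r)
  entered : ∀ i < P.committee, (w.info i).entered = true
  left : ∀ i, (w.info i).asked = false → (w.info i).left = false
  cursor : ∀ i < P.committee + P.committee, ∀ j, (w.loc (.node i)).cursor j =
    if i < P.committee ∨ a.eval κ < r then r - 1 else 0
  sent : ∀ i < P.committee, (w.info i).sent.map Prod.fst = (List.range r).reverse
  fresh : r ≤ a.eval κ → ∀ i, P.committee ≤ i → (w.info i).sent = []
  client_zero : r ≤ a.eval κ →
    w.loc (.client 0) = { state := .leaf, cursor := fun _ => 0, log := [], time := 0 }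
  client_one : r ≤ a.eval κ + b.eval κ →
    w.loc (.client 1) = { state := .leaf, cursor := fun _ => 0, log := [], time := 0 }

theorem runs_envOrders {w : World} (h : EnvInvariant P a b κ r w) (i : ℕ) :
    (session P (env P a b) κ ω).runs w (envOrders ω r) i =
      decide (i < P.committee ∨ i < P.committee + P.committee ∧ a.eval κ ≤ r) := by
  rw [runs, N_env, corrupt_env, joined_envOrders, seized_envOrders, h.seized, h.joined]
  simp only [Bool.not_false, Bool.and_true, ← Bool.decide_or, ← Bool.decide_and,
    decide_eq_decide]
  omega

theorem cursor_envOrders (w : World) (p : Party) (j : ℕ) :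
    (session P (env P a b) κ ω).cursor r w (envOrders ω r) p j =
      max ((w.loc p).cursor j) r := by
  simp [Session.cursor, netOrder_envOrders]

theorem online_envOrders_zero :
    (session P (env P a b) κ ω).online (envOrders ω r) 0 = decide (a.eval κ ≤ r) := by
  simp [online, K_env, clientOrder_envOrders_zero]

theorem online_envOrders_one :
    (session P (env P a b) κ ω).online (envOrders ω r) 1 =
      decide (a.eval κ + b.eval κ ≤ r) := by
  simp [online, K_env, clientOrder_envOrders_one]

theorem envInvariant {r : ℕ} (hr : r ≤ (env P a b).slots.eval κ) :
    EnvInvariant P a b κ r (worldAt P (env P a b) κ ω r) := by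
  refine worldAt_induction P (env P a b) κ ω (p := EnvInvariant P a b κ) ?_ ?_ hr
  · constructor <;> simp +contextual [init]
    exact fun i => decide_eq_decide.2 Iff.rfl
  · intro r hr h
    have hrun := runs_envOrders ω ⟨r, hr⟩ h
    have hon0 := online_envOrders_zero ω ⟨r, hr⟩
    have hon1 := online_envOrders_one ω ⟨r, hr⟩
    have hcur := fun i => cursor_envOrders ω ⟨r, hr⟩ (worldAt P (env P a b) κ ω r) (.node i)
    have hj := joined_envOrders ω ⟨r, hr⟩ (worldAt P (env P a b) κ ω r)
    have hs := seized_envOrders ω ⟨r, hr⟩ (worldAt P (env P a b) κ ω r)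
    have hask := asked_envOrders ω ⟨r, hr⟩
    rw [envOrders] at hrun hon0 hon1 hj hs hcur hask
    constructor
    · intro i
      rw [next_seized, session_att, hs, h.seized]
    · intro i
      rw [next_joined, session_att, hj, h.joined, ← Bool.decide_or, decide_eq_decide]
      dsimp only
      omega
    · intro i
      have := h.asked i
      simp only [next, session_att, hrun]
      split_ifs with h1
      · simp only [stepInfo, hask, this, ← Bool.decide_or, decide_eq_decide]
        omega
      · simp only [this, decide_eq_decide]
        simp only [decide_eq_true_eq] at h1
        omega
    · intro i hi
      simp only [next, session_att, hrun]
      split_ifs with h1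
      · simp [stepInfo, h.entered i hi]
      · simp [h.entered i hi]
    · intro i
      simp only [next, session_att, hrun]
      split_ifs with h1
      · simp only [stepInfo, Bool.or_eq_false_iff]
        intro h2
        simp [h.left i h2.1, h2.1]
      · exact h.left i
    · intro i hi j
      have hc := h.cursor i hi j
      simp only [next, session_att, hrun, decide_eq_true_eq]
      split_ifs at hc ⊢ <;> (try simp only [stepLocal, hcur]) <;> omega
    · intro i hi
      simp only [next, session_att, hrun]
      rw [if_pos (by simp [hi])]
      simp [stepInfo, h.sent i hi, List.range_succ]
    · intro h1 i hi
      simp only [next, session_att, hrun]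
      rw [if_neg (by simp; omega)]
      exact h.fresh (by omega) i hi
    · intro h1
      simp only [next, session_att, hon0]
      rw [if_neg (by simp; omega)]
      exact h.client_zero (by omega)
    · intro h1
      simp only [next, session_att, hon1]
      rw [if_neg (by simp; omega)]
      exact h.client_one (by omega)

theorem env_worldAt_seized (r i : ℕ) :
    ((worldAt P (env P a b) κ ω r).info i).seized = false := by
  rcases le_total r ((env P a b).slots.eval κ) with h | h
  · exact (envInvariant ω h).seized i
  · rw [worldAt_of_le _ _ _ _ h]; exact (envInvariant ω le_rfl).seized i

theorem corruptions_env (P : Protocol) (a b : Polynomial ℕ) (κ : ℕ) :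
    (env P a b).corruptions P κ = 0 := by
  simp [Attacker.corruptions, Attacker.IsCorrupt, env, Prog.eval]

theorem fillsQueue_env (P : Protocol) (a b : Polynomial ℕ) : (env P a b).FillsQueue P := by
  have key : ∀ κ (ω : Coins P (env P a b) κ) r, r ≤ (env P a b).slots.eval κ →
      {i | ((worldAt P (env P a b) κ ω r).info i).asked = true}.ncard ≤
      {i | P.committee ≤ i ∧ i < (env P a b).numNodes P κ ∧
        ((worldAt P (env P a b) κ ω r).info i).joined = true}.ncard := by
    intro κ ω r hr
    have h := envInvariant ω hr
    have hN : (env P a b).numNodes P κ = P.committee + P.committee := N_env ω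
    refine Set.ncard_le_ncard_of_injOn (fun i => P.committee + i) ?_
      (fun i _ j _ hij => by simpa using hij) ((Set.finite_Iio (P.committee + P.committee)).subset ?_)
    · intro i hi
      simp only [Set.mem_ofPred_eq, h.asked, h.joined, decide_eq_true_eq, hN] at hi ⊢
      omega
    · intro i hi
      simp only [Set.mem_ofPred_eq, hN] at hi
      exact hi.2.1
  intro κ ω r
  rcases le_total r ((env P a b).slots.eval κ) with h | h
  · exact key κ ω r h
  · rw [worldAt_of_le _ _ _ _ h]; exact key κ ω _ le_rfl

end Env


open Session

/-! ### The honest execution: running time -/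

theorem size_perNode_le (s : Session) {f : ℕ → Data} {k : ℕ} (h : ∀ i < s.N, (f i).size ≤ k) :
    (s.perNode f).size ≤ 1 + s.N * (1 + k) := by
  refine (Data.size_ofList_le (k := k) ?_).trans (by simp)
  simpa using h

/-- A bound on what the attacker reads in a slot, from bounds on the parts. -/
theorem size_advInput_le {s : Session} {r : ℕ} {w : World} {coins : Data} {S R X B : ℕ}
    (hr : r ≤ S) (hkey : ∀ i < s.N, s.corrupt i = true → (s.key i).snd.size ≤ X)
    (hpks : s.pks.size ≤ X) (hstate : w.advState.size ≤ R)
    (hmsg : ∀ i < s.N, (Data.ofList (((w.info i).sent.filter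
      fun m => m.1 + 1 = r).map Prod.snd)).size ≤ X)
    (hseized : ∀ i, (w.info i).seized = false) (hcoins : coins.size ≤ B) :
    (s.advInput r w coins).size ≤
      1 + 8 * (1 + ((1 + s.κ * 2) + (1 + S * 2) + R + B + (1 + s.N * (1 + (1 + X))))) := by
  refine (Data.size_ofList_le (k := ((1 + s.κ * 2) + (1 + S * 2) + R + B +
    (1 + s.N * (1 + (1 + X))))) ?_).trans (by simp)
  have hpks' : s.pks.size ≤ 1 + s.N * (1 + (1 + X)) := by
    rcases Nat.eq_zero_or_pos s.N with h0 | h0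
    · simp [pks, perNode, h0, Data.size]
    · nlinarith
  have h1 : (s.perNode fun i => if s.corrupt i then (s.key i).snd else .leaf).size ≤
      1 + s.N * (1 + (1 + X)) := by
    refine size_perNode_le s fun i hi => ?_
    split_ifs with h
    · exact (hkey i hi h).trans (by omega)
    · simp [Data.size]
  have h2 : (s.perNode fun i =>
      .ofList (((w.info i).sent.filter fun m => m.1 + 1 = r).map Prod.snd)).size ≤
      1 + s.N * (1 + (1 + X)) :=
    size_perNode_le s fun i hi => (hmsg i hi).trans (by omega)
  have h3 : (s.perNode fun i =>
      if (w.info i).seized then (w.loc (.node i)).state else .leaf).size ≤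
      1 + s.N * (1 + (1 + X)) := by
    refine size_perNode_le s fun i hi => ?_
    simp [hseized, Data.size]
  have h4 := Data.size_ofNat_le s.κ
  have h5 := Data.size_ofNat_le r
  simp only [List.mem_cons, List.not_mem_nil, or_false, forall_eq_or_imp, forall_eq]
  refine ⟨?_, ?_, ?_, ?_, ?_, ?_, ?_, ?_⟩ <;> omega

section Env

variable {P : Protocol} {a b : Polynomial ℕ}

theorem exists_load_env_le (P : Protocol) (a b : Polynomial ℕ) :
    ∃ L, PolyBounded L ∧ ∀ κ (ω : Coins P (env P a b) κ) r, r ≤ (env P a b).slots.eval κ →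
      (worldAt P (env P a b) κ ω r).load ≤ L κ := by
  refine ⟨fun κ => (env P a b).slots.eval κ * ((P.committee + P.committee) *
    (20 + 4 * P.committee + 4 * κ)), (PolyBounded.eval _).mul ((PolyBounded.const _).mul
      ((PolyBounded.const _).add ((PolyBounded.const 4).mul .self))), fun κ ω r hr => ?_⟩
  refine le_trans ?_ (Nat.mul_le_mul_right _ hr)
  refine worldAt_induction P (env P a b) κ ω
    (p := fun r w => w.load ≤ r * ((P.committee + P.committee) *
      (20 + 4 * P.committee + 4 * κ))) (by simp [init]) ?_ hr
  intro r hr h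
  rw [add_one_mul]
  refine Nat.add_le_add h ?_
  rw [N_env]
  refine (Finset.sum_le_card_nsmul _ _ (20 + 4 * P.committee + 4 * κ) fun i hi => ?_).trans
    (by simp)
  have hin := inputs_envOrders ω ⟨r, hr⟩ i
  rw [envOrders] at hin
  simp only [session_att, hin]
  have h1 := Data.size_ofNat_le i
  have h2 : (payload ω ⟨r, hr⟩).size ≤ 1 + κ * 4 :=
    (Data.size_ofBits_le _).trans (by
      change 1 + (Polynomial.X : Polynomial ℕ).eval κ * 4 ≤ _; simp)
  have h3 : (withdrawTx i).size = 6 + (Data.ofNat i).size := by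
    simp [withdrawTx, Data.size, Data.ofNat, List.replicate]
  have h4 : (stakeTx i).size = 4 + (Data.ofNat i).size := by
    simp [stakeTx, Data.size, Data.ofNat]
  have h5 : (payTx (payload ω ⟨r, hr⟩)).size = 2 + (payload ω ⟨r, hr⟩).size := by
    simp [payTx, Data.size]
  have hi' := Finset.mem_range.1 hi
  split_ifs <;> simp <;> omega

/-- In the honest execution everybody's running time is polynomial. -/
theorem exists_time_env_le (hP : P.Efficient) (a b : Polynomial ℕ) :
    ∃ G, PolyBounded G ∧ ∀ κ (ω : Coins P (env P a b) κ) r, r ≤ (env P a b).slots.eval κ →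
      ∀ q, ((worldAt P (env P a b) κ ω r).loc q).time ≤ G κ := by
  obtain ⟨p, hp⟩ := hP
  obtain ⟨L, hL, hload⟩ := exists_load_env_le P a b
  refine ⟨fun κ => p.eval (κ + (P.committee + (env P a b).candidates.eval κ) +
    (env P a b).slots.eval κ + L κ),
    .eval_comp p (((PolyBounded.self.add ((PolyBounded.const _).add (.eval _))).add
      (.eval _)).add hL), fun κ ω r hr q => ?_⟩
  refine (hp _ κ ω r (corruptions_env P a b κ) (env_worldAt_seized ω r) q).trans
    (eval_le_eval p ?_)
  exact Nat.add_le_add (Nat.add_le_add_left hr _) (hload κ ω r hr)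

theorem slots_env_pos {κ : ℕ} : 0 < (env P a b).slots.eval κ := by
  rw [eval_slots_env]; omega

variable {κ : ℕ} (ω : Coins P (env P a b) κ)

/-- What the code of `p` is given in slot `r` of the honest execution. -/
noncomputable def envInput (r : Fin ((env P a b).slots.eval κ)) (p : Party) : Data :=
  (session P (env P a b) κ ω).stepInput r (worldAt P (env P a b) κ ω r) (envOrders ω r)
    (partyCoins P (env P a b) κ ω r p) p

variable (r : Fin ((env P a b).slots.eval κ))

/-- Node `i` executes its code in slot `r` of the honest execution, if the candidates come in in
slot `t0`. -/
def Participates (P : Protocol) (t0 r i : ℕ) : Prop :=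
  i < P.committee ∨ i < P.committee + P.committee ∧ t0 ≤ r

theorem loc_env_node_succ {i : ℕ} (hi : Participates P (a.eval κ) r i) :
    (worldAt P (env P a b) κ ω (r + 1)).loc (.node i) =
      (session P (env P a b) κ ω).stepLocal r (worldAt P (env P a b) κ ω r) (envOrders ω r)
        (partyCoins P (env P a b) κ ω r (.node i)) (.node i)
        (!((worldAt P (env P a b) κ ω r).info i).left) := by
  have h := runs_envOrders ω r (envInvariant ω r.2.le) i
  rw [decide_eq_true (p := i < P.committee ∨ _) hi, envOrders] at h
  rw [worldAt_env_succ, next]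
  simp only [session_att, h, if_true]
  rfl

theorem info_env_succ {i : ℕ} (hi : Participates P (a.eval κ) r i) :
    (worldAt P (env P a b) κ ω (r + 1)).info i =
      (session P (env P a b) κ ω).stepInfo r (worldAt P (env P a b) κ ω r) (envOrders ω r)
        (partyCoins P (env P a b) κ ω r (.node i)) i := by
  have h := runs_envOrders ω r (envInvariant ω r.2.le) i
  rw [decide_eq_true (p := i < P.committee ∨ _) hi, envOrders] at h
  rw [worldAt_env_succ, next]
  simp only [session_att, h, if_true]
  rfl

theorem loc_env_client_zero_succ (h0 : a.eval κ ≤ r) :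
    (worldAt P (env P a b) κ ω (r + 1)).loc (.client 0) =
      (session P (env P a b) κ ω).stepLocal r (worldAt P (env P a b) κ ω r) (envOrders ω r)
        (partyCoins P (env P a b) κ ω r (.client 0)) (.client 0) true := by
  have h := online_envOrders_zero ω r
  rw [decide_eq_true h0, envOrders] at h
  rw [worldAt_env_succ, next]
  simp only [session_att, h, if_true]
  rfl

theorem loc_env_client_one_succ (h0 : a.eval κ + b.eval κ ≤ r) :
    (worldAt P (env P a b) κ ω (r + 1)).loc (.client 1) =
      (session P (env P a b) κ ω).stepLocal r (worldAt P (env P a b) κ ω r) (envOrders ω r)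
        (partyCoins P (env P a b) κ ω r (.client 1)) (.client 1) true := by
  have h := online_envOrders_one ω r
  rw [decide_eq_true h0, envOrders] at h
  rw [worldAt_env_succ, next]
  simp only [session_att, h, if_true]
  rfl

variable {G : ℕ}
  (hG : ∀ r ≤ (env P a b).slots.eval κ, ∀ q, ((worldAt P (env P a b) κ ω r).loc q).time ≤ G)

include hG

theorem cost_env_node_le {i : ℕ} (hi : Participates P (a.eval κ) r i) :
    P.step.cost (envInput ω r (.node i)) ≤ G := by
  have h := hG (r + 1) r.2 (.node i)
  rw [loc_env_node_succ ω r hi] at h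
  exact (Nat.le_add_left _ _).trans h

theorem size_state_env_le {i : ℕ} (hi : i < P.committee) {r : ℕ}
    (hr : r < (env P a b).slots.eval κ) :
    ((worldAt P (env P a b) κ ω r).loc (.node i)).state.size ≤ G := by
  refine le_trans ?_ (cost_env_node_le ω ⟨r, hr⟩ hG (i := i) (.inl hi))
  refine le_trans ?_ (P.step.lt_cost _).le
  have := Data.size_nth_le (envInput ω ⟨r, hr⟩ (.node i)) 4
  simpa [envInput, stepInput] using this

/-- Nothing is assumed about the cost of key generation, but a validator has to read its secret key
in slot `0`. -/
theorem size_secret_env_le {i : ℕ} (hi : i < P.committee) :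
    ((session P (env P a b) κ ω).key i).snd.size ≤ G :=
  size_state_env_le ω hG hi (slots_env_pos)

/-- The public keys are read by everybody in every slot. -/
theorem size_pks_env_le : (session P (env P a b) κ ω).pks.size ≤ G := by
  refine le_trans ?_ (cost_env_node_le ω ⟨0, slots_env_pos⟩ hG (.inl P.committee_pos))
  refine le_trans ?_ (P.step.lt_cost _).le
  have := Data.size_nth_le (envInput ω ⟨0, slots_env_pos⟩ (.node 0)) 1
  simpa [envInput, stepInput] using this

end Env

theorem isPPT_env {P : Protocol} (hP : P.Efficient) (a b : Polynomial ℕ) :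
    (env P a b).IsPPT P := by
  obtain ⟨G, hG, hGt⟩ := exists_time_env_le hP a b
  obtain ⟨c, hc⟩ := isPoly_env_step P a b
  refine isPPT_of_cost_le (f := fun κ => c.eval (1 + 8 * (1 + ((1 + κ * 2) +
    (1 + (env P a b).slots.eval κ * 2) + 1 + (1 + 3 * (1 + (1 + (a.eval κ + b.eval κ + κ) * 4))) +
    (1 + (P.committee + P.committee) * (1 + (1 + (1 + 2 * G κ)))))))) P _ ?_ ?_ .nil
  · have hc := PolyBounded.const
    have hid := PolyBounded.self
    have he := PolyBounded.eval
    exact .eval_comp c ((hc 1).add ((hc 8).mul ((hc 1).add ((((((hc 1).add (hid.mul (hc 2))).add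
      ((hc 1).add ((he _).mul (hc 2)))).add (hc 1)).add ((hc 1).add ((hc 3).mul ((hc 1).add
      ((hc 1).add ((((he a).add (he b)).add hid).mul (hc 4))))))).add ((hc 1).add
      ((hc _).mul ((hc 1).add ((hc 1).add ((hc 1).add ((hc 2).mul hG))))))))))
  · intro κ ω r hr
    refine (hc _).trans (eval_le_eval c ?_)
    have h := hGt κ ω
    have hN := N_env ω
    refine (size_advInput_le (S := (env P a b).slots.eval κ) (R := 1)
      (B := 1 + 3 * (1 + (1 + (a.eval κ + b.eval κ + κ) * 4))) (X := 1 + 2 * G κ) hr.le ?_ ?_ ?_ ?_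
      (env_worldAt_seized ω r) ?_).trans (by rw [hN]; rfl)
    · intro i _ hi
      simp [corrupt_env] at hi
    · exact (size_pks_env_le ω h).trans (by omega)
    · rcases r with _ | r
      · simp [worldAt_zero, init, Data.size]
      · rw [worldAt_succ _ _ _ _ (Nat.lt_of_succ_lt hr)]
        exact le_rfl
    · intro i hi
      exact (size_messages_le P _ κ ω i r).trans (by have := h r hr.le (.node i); omega)
    · refine (Data.size_ofList_le (k := 1 + (a.eval κ + b.eval κ + κ) * 4) ?_).trans
        (by rw [List.length_ofFn]; exact le_rfl)
      simp only [List.mem_ofFn, forall_exists_index, forall_apply_eq_imp_iff]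
      intro j
      refine (Data.size_ofBits_le _).trans ?_
      have hj : (envBits a b j).eval κ ≤ a.eval κ + b.eval κ + κ := by
        rcases j with ⟨_ | _ | j, hj⟩ <;> simp [envBits]
        omega
      have : ((env P a b).blockBits j).eval κ ≤ a.eval κ + b.eval κ + κ := hj
      omega


/-! ### The honest execution: what the clients see -/

section Env

variable {P : Protocol} {a b : Polynomial ℕ} {κ : ℕ} (ω : Coins P (env P a b) κ)

/-- The slot in which client `0` comes online. -/
def earlySlot (P : Protocol) (a b : Polynomial ℕ) (κ : ℕ) : Fin ((env P a b).slots.eval κ) :=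
  ⟨a.eval κ, by rw [eval_slots_env]; omega⟩

/-- The slot in which client `1` comes online. -/
def lastSlot (P : Protocol) (a b : Polynomial ℕ) (κ : ℕ) : Fin ((env P a b).slots.eval κ) :=
  ⟨a.eval κ + b.eval κ, by rw [eval_slots_env]; omega⟩

/-- What the code of a client outputs in slot `r`, as a record. -/
noncomputable def envEntry (r : Fin ((env P a b).slots.eval κ)) (p : Party) : Entry where
  slot := r
  inbox := (session P (env P a b) κ ω).inbox r (worldAt P (env P a b) κ ω r) (envOrders ω r) p
  chain := ((P.step.eval (envInput ω r p)).nth 2).toList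
  released := ((P.step.eval (envInput ω r p)).nth 3).toList.map Data.len

/-- The record of client `0` when it comes online in the honest execution. -/
noncomputable def earlyEntry : Entry := envEntry ω (earlySlot P a b κ) (.client 0)

/-- The record of client `1` when it comes online in the honest execution. -/
noncomputable def lastEntry : Entry := envEntry ω (lastSlot P a b κ) (.client 1)

theorem log_env_client_zero :
    ((worldAt P (env P a b) κ ω (a.eval κ + 1)).loc (.client 0)).log = [earlyEntry ω] := by
  change ((worldAt P _ κ ω (earlySlot P a b κ + 1)).loc (.client 0)).log = _
  rw [loc_env_client_zero_succ ω (earlySlot P a b κ) le_rfl, stepLocal, if_pos rfl,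
    (envInvariant ω (earlySlot P a b κ).2.le).client_zero le_rfl]
  rfl

theorem log_env_client_one :
    ((final P (env P a b) κ ω).loc (.client 1)).log = [lastEntry ω] := by
  rw [final, eval_slots_env]
  change ((worldAt P _ κ ω (lastSlot P a b κ + 1)).loc (.client 1)).log = _
  rw [loc_env_client_one_succ ω (lastSlot P a b κ) le_rfl, stepLocal,
    if_pos rfl, (envInvariant ω (lastSlot P a b κ).2.le).client_one le_rfl]
  rfl

theorem earlyEntry_mem :
    earlyEntry ω ∈ ((final P (env P a b) κ ω).loc (.client 0)).log :=
  mem_log_final P _ κ ω (r := a.eval κ + 1) (by rw [log_env_client_zero]; simp)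

theorem lastEntry_mem :
    lastEntry ω ∈ ((final P (env P a b) κ ω).loc (.client 1)).log := by
  rw [log_env_client_one]; simp

theorem mem_submitted_env {r : Fin ((env P a b).slots.eval κ)} (hr : r ≤ a.eval κ) {i : ℕ}
    (hi : i < P.committee) {t : Data} (ht : t ∈ tasks (envOrders ω r) i) :
    ((r : ℕ), t) ∈ (final P (env P a b) κ ω).submitted := by
  refine mem_submitted_final P _ κ ω (r := r + 1) ?_
  have h := envInvariant ω r.2.le
  have hrun := runs_envOrders ω r h i
  have hl := h.left i (by rw [h.asked]; simp; omega)
  rw [decide_eq_true (.inl hi)] at hrun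
  rw [envOrders] at hrun ht
  rw [worldAt_env_succ, next]
  refine List.mem_append_left _ (List.mem_flatMap.2 ⟨i, ?_, ?_⟩)
  · rw [N_env, List.mem_range]; omega
  · simp only [session_att, hrun, h.entered i hi, hl]
    simpa using ht

theorem payload_submitted : (0, payTx (payload ω ⟨0, slots_env_pos⟩)) ∈
    (final P (env P a b) κ ω).submitted := by
  refine mem_submitted_env ω (r := ⟨0, slots_env_pos⟩) (Nat.zero_le _) P.committee_pos ?_
  have := P.committee_pos
  rw [tasks, nodeOrder_envOrders]
  simp [this]

theorem withdrawal_submitted {i : ℕ} (hi : i < P.committee) :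
    (a.eval κ, withdrawTx i) ∈ (final P (env P a b) κ ω).submitted := by
  refine mem_submitted_env ω (r := earlySlot P a b κ) le_rfl hi ?_
  have : i < P.committee + P.committee := by omega
  rw [tasks, nodeOrder_envOrders]
  simp [this, hi, earlySlot]

/-- By liveness, whoever comes online late enough has seen the first payload. -/
theorem payload_mem_of_live {T : ℕ} (hT : T ≤ a.eval κ)
    (h : LiveWithin P (env P a b) κ ω T) :
    payTx (payload ω ⟨0, slots_env_pos⟩) ∈ (earlyEntry ω).chain.txs ∧
      payTx (payload ω ⟨0, slots_env_pos⟩) ∈ (lastEntry ω).chain.txs := by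
  have h' := h _ _ (payload_submitted ω)
  refine ⟨h' _ _ (earlyEntry_mem ω) ?_, h' _ _ (lastEntry_mem ω) ?_⟩
  · change 0 + T ≤ a.eval κ; omega
  · change 0 + T ≤ a.eval κ + b.eval κ; omega

/-- The initial validators have withdrawn in the view of client `1`. -/
theorem released_of_live {T U : ℕ} (hT : T + U ≤ b.eval κ)
    (h : LiveWithin P (env P a b) κ ω T) (h' : ReleasedWithin P (env P a b) κ ω U)
    {i : ℕ} (hi : i < P.committee) : i ∈ (lastEntry ω).released := by
  obtain ⟨e, he, -, hie⟩ := h' _ i (withdrawal_submitted ω hi) (a.eval κ + T) (by omega)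
    (fun p e he hs => h _ _ (withdrawal_submitted ω hi) p e he hs) _ _ (lastEntry_mem ω)
    (by change _ ≤ a.eval κ + b.eval κ; omega)
  rw [log_env_client_one, List.mem_singleton] at he
  rwa [he] at hie

variable {G : ℕ}
  (hG : ∀ r ≤ (env P a b).slots.eval κ, ∀ q, ((worldAt P (env P a b) κ ω r).loc q).time ≤ G)

include hG

theorem length_txs_envEntry_le (r : Fin ((env P a b).slots.eval κ)) (p : Party)
    (h : P.step.cost (envInput ω r p) ≤ ((worldAt P (env P a b) κ ω (r + 1)).loc p).time) :
    (envEntry ω r p).chain.txs.length ≤ G :=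
  ((Data.length_txs_lt_size _).le.trans (Data.size_nth_le _ 2)).trans
    ((P.step.size_eval_le_cost _).trans (h.trans (hG _ r.2 p)))

theorem length_txs_earlyEntry_le : (earlyEntry ω).chain.txs.length ≤ G := by
  refine length_txs_envEntry_le ω hG _ _ ?_
  rw [loc_env_client_zero_succ ω (earlySlot P a b κ) le_rfl]
  exact Nat.le_add_left _ _

theorem length_txs_lastEntry_le : (lastEntry ω).chain.txs.length ≤ G := by
  refine length_txs_envEntry_le ω hG _ _ ?_
  rw [loc_env_client_one_succ ω (lastSlot P a b κ) le_rfl]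
  exact Nat.le_add_left _ _

end Env


/-! ### The attack: programs -/

/-- The lengths of the random strings of the attacker in a slot: two timers, the payloads of the two
simulated executions, and the coins of their validators. -/
noncomputable def attackBits (P : Protocol) (a b : Polynomial ℕ) : ℕ → Polynomial ℕ
  | 0 => a
  | 1 => a + b
  | 2 => .X
  | 3 => .X
  | _ + 4 => P.coinBits

namespace Sim

/-- The current state of the simulated validator `i`: its secret key at the beginning, and what the
attacker has stored later on. -/
def state (c i : ℕ) : Prog :=
  .ite (.arg 4) (.comp (.arg i) (.comp (.arg (2 * c)) (.arg 4))) (.comp (.arg i) (.arg 2))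

/-- The messages that the simulated validator `i` has sent, the latest first. -/
def history (c i : ℕ) : Prog := .comp (.arg i) (.comp (.arg (2 * c + 1)) (.arg 4))

/-- The message that the simulated validator `i` sent in the previous slot, as a list. -/
def latest (c i : ℕ) : Prog :=
  .ite (history c i) (.list [.comp .fst (history c i)]) .nil

/-- The messages that reach a simulated validator. Only the first simulation takes up the messages
of the honest candidates. -/
def inbox (n c : ℕ) : Prog :=
  .list ((List.range (n + n)).map fun j =>
    if j < n then latest c j else if c = 0 then .comp (.arg j) (.arg 5) else .nil)

/-- The transactions that are input to the simulated validator `i`. -/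
def inputs (c i : ℕ) : Prog :=
  .ite (.due (.coin 0)) (.list [.const (withdrawTx i), .pair .nil (.coin (c + 2))])
    (.list [.pair .nil (.coin (c + 2))])

/-- What the code of the simulated validator `i` is given. -/
def input (n c i : ℕ) : Prog :=
  .list [.arg 0, .arg 1, .const (role (.node i)), .arg 3, state c i, inbox n c, inputs c i,
    .coin (c * n + i + 4)]

/-- A program that is not executed any more once the first timer has run down. -/
def early (p : Prog) : Prog := .ite (.due (.coin 0)) .nil p

/-- The first stage: the code of the validators is executed, in the second simulation only until
the first timer has run down. The output lists the data received, and the outputs of the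
validators in the two simulations. -/
def simulate (n : ℕ) (step : Prog) : Prog :=
  .list [.id, .list ((List.range n).map fun i => .comp step (input n 0 i)),
    .list ((List.range n).map fun i => early (.comp step (input n 1 i)))]

/-- What is sent to the honest candidates in the name of `j`: everything when they come in, and the
message of the previous slot later on. -/
def mail (j : ℕ) : Prog := .ite (.due (.pair .nil (.coin 0))) (latest 0 j) (history 0 j)

def candidateOrder (n : ℕ) : Prog :=
  .list [.due (.coin 0), .nil, .nil, .list ((List.range n).map fun j => .pair .nil (mail j))]

def clientOrder (n c : ℕ) (timer : Prog) : Prog :=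
  .list [.due timer, .list ((List.range n).map fun j => .pair .nil (history c j))]

def newState (c i : ℕ) : Prog := .comp (.arg 0) (.comp (.arg i) (.arg (c + 1)))

def newHistory (c i : ℕ) : Prog :=
  .pair (.comp (.arg 1) (.comp (.arg i) (.arg (c + 1)))) (.comp (history c i) (.arg 0))

/-- A program on the output of `simulate` that yields nothing once the first timer has run down. -/
def earlyAfter (p : Prog) : Prog := .ite (.comp (.due (.coin 0)) (.arg 0)) .nil p

/-- The second stage: the new state of the attacker, and the orders. -/
def conclude (n : ℕ) : Prog :=
  .list
    [.list
      [.list ((List.range n).map (newState 0)), .list ((List.range n).map (newHistory 0)),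
        earlyAfter (.list ((List.range n).map (newState 1))),
        earlyAfter (.list ((List.range n).map (newHistory 1)))],
      .list ((List.range (n + n)).map fun i =>
        if i < n then .nil else .comp (candidateOrder n) (.arg 0)),
      .comp (.list [clientOrder n 1 (.coin 0), clientOrder n 0 (.coin 1)]) (.arg 0)]

theorem isPoly_history (c i : ℕ) : (history c i).IsPoly := .comp (.arg i) (.comp (.arg _) (.arg 4))

theorem isPoly_latest (c i : ℕ) : (latest c i).IsPoly :=
  .ite (isPoly_history c i) (.list (by simpa using .comp .fst (isPoly_history c i))) .nil

theorem isPoly_inbox (n c : ℕ) : (inbox n c).IsPoly := by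
  refine .list ?_
  simp only [List.mem_map, forall_exists_index, and_imp, forall_apply_eq_imp_iff₂]
  intro j _
  split_ifs
  · exact isPoly_latest c j
  · exact .comp (.arg j) (.arg 5)
  · exact .nil

theorem isPoly_inputs (c i : ℕ) : (inputs c i).IsPoly := by
  have h : (Prog.pair .nil (.coin (c + 2))).IsPoly := .pair .nil (.coin _)
  refine .ite (.due (.coin 0)) (.list ?_) (.list (by simpa using h))
  simpa using ⟨.const _, h⟩

theorem isPoly_input (n c i : ℕ) : (input n c i).IsPoly := by
  refine .list ?_
  simp only [List.mem_cons, List.not_mem_nil, or_false, forall_eq_or_imp, forall_eq]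
  exact ⟨.arg 0, .arg 1, .const _, .arg 3,
    .ite (.arg 4) (.comp (.arg i) (.comp (.arg _) (.arg 4))) (.comp (.arg i) (.arg 2)),
    isPoly_inbox n c, isPoly_inputs c i, .coin _⟩

theorem isPoly_list_map_range {n : ℕ} {f : ℕ → Prog} (h : ∀ i, (f i).IsPoly) :
    (Prog.list ((List.range n).map f)).IsPoly := by
  refine .list ?_
  simp only [List.mem_map, forall_exists_index, and_imp, forall_apply_eq_imp_iff₂]
  exact fun i _ => h i

theorem isPoly_conclude (n : ℕ) : (conclude n).IsPoly := by
  have hstate : ∀ c i, (newState c i).IsPoly := fun c i =>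
    .comp (.arg 0) (.comp (.arg i) (.arg _))
  have hhist : ∀ c i, (newHistory c i).IsPoly := fun c i =>
    .pair (.comp (.arg 1) (.comp (.arg i) (.arg _))) (.comp (isPoly_history c i) (.arg 0))
  have hearly : ∀ {p : Prog}, p.IsPoly → (earlyAfter p).IsPoly := fun hp =>
    .ite (.comp (.due (.coin 0)) (.arg 0)) .nil hp
  have hclient : ∀ c k, (clientOrder n c (.coin k)).IsPoly := fun c k => .list <| by
    simpa using ⟨.due (.coin k), isPoly_list_map_range fun j => .pair .nil (isPoly_history c j)⟩
  refine .list ?_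
  simp only [List.mem_cons, List.not_mem_nil, or_false, forall_eq_or_imp, forall_eq]
  refine ⟨.list ?_, isPoly_list_map_range fun i => ?_, .comp (.list ?_) (.arg 0)⟩
  · simp only [List.mem_cons, List.not_mem_nil, or_false, forall_eq_or_imp, forall_eq]
    exact ⟨isPoly_list_map_range (hstate 0), isPoly_list_map_range (hhist 0),
      hearly (isPoly_list_map_range (hstate 1)), hearly (isPoly_list_map_range (hhist 1))⟩
  · split_ifs
    · exact .nil
    · refine .comp (.list ?_) (.arg 0)
      simp only [List.mem_cons, List.not_mem_nil, or_false, forall_eq_or_imp, forall_eq]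
      exact ⟨.due (.coin 0), .nil, .nil, isPoly_list_map_range fun j => .pair .nil <|
        .ite (.due (.pair .nil (.coin 0))) (isPoly_latest 0 j) (isPoly_history 0 j)⟩
  · simpa using ⟨hclient 1 0, hclient 0 1⟩

end Sim

/-- The attack on the protocol. The initial validators are corrupted, the candidates are not. The
attacker simulates two independent executions with honest validators. The first one involves the
honest candidates, and it is what client `1` gets to see in slot `a + b`, after the initial
validators have withdrawn; the second one, in which nobody but the initial validators takes part,
is shown to client `0` in slot `a`. -/
noncomputable def attack (P : Protocol) (a b : Polynomial ℕ) : Attacker where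
  candidates := .C P.committee
  clients := .C 2
  slots := a + b + 1
  blocks := P.committee + P.committee + 4
  blockBits j := attackBits P a b j
  corrupt := .const (.ofList (List.replicate P.committee (.ofBool true)))
  step := .comp (Sim.conclude P.committee) (Sim.simulate P.committee P.step)

/-! ### The attack: coin tosses -/

section Coins

variable {P : Protocol} {a b : Polynomial ℕ} {κ : ℕ}

theorem coinIndex_lt (c : Fin 2) {i : ℕ} (hi : i < P.committee) :
    c * P.committee + i + 4 < (attack P a b).blocks := by
  change c * P.committee + i + 4 < P.committee + P.committee + 4
  fin_cases c <;> simp <;> omega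

/-- The payload of the transactions in the simulated execution `c`. -/
def simPayload (c : Fin 2) (ω : Coins P (attack P a b) κ)
    (r : Fin ((attack P a b).slots.eval κ)) : Fin ((Polynomial.X : Polynomial ℕ).eval κ) → Bool :=
  match c with
  | 0 => (ω.2 r).2.2 ⟨2, Nat.lt_add_left _ (by decide : 2 < 4)⟩
  | 1 => (ω.2 r).2.2 ⟨3, Nat.lt_add_left _ (by decide : 3 < 4)⟩

/-- The coin tosses of the simulated execution `c`: the honest execution that the attack imitates. -/
def simCoins (c : Fin 2) (ω : Coins P (attack P a b) κ) : Coins P (env P a b) κ :=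
  (ω.1, fun r =>
    (fun i => if h : i < P.committee then (ω.2 r).2.2 ⟨c * P.committee + i + 4, coinIndex_lt c h⟩
      else (ω.2 r).1 i,
    (ω.2 r).2.1,
    fun j => match j with
      | ⟨0, _⟩ => (ω.2 r).2.2 ⟨0, Nat.lt_add_left _ (by decide : 0 < 4)⟩
      | ⟨1, _⟩ => (ω.2 r).2.2 ⟨1, Nat.lt_add_left _ (by decide : 1 < 4)⟩
      | ⟨_ + 2, _⟩ => simPayload c ω r))

end Coins


/-! ### The attack: the simulated executions -/

theorem filter_latest {l : List (ℕ × Data)} {r : ℕ} (h : l.map Prod.fst = (List.range r).reverse) :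
    (l.filter fun m => decide (r - 1 ≤ m.1) && decide (m.1 < r)) = l.take 1 := by
  cases r with
  | zero =>
    rw [List.range_zero, List.reverse_nil, List.map_eq_nil_iff] at h
    simp [h]
  | succ k =>
    rw [List.range_succ, List.reverse_append, List.reverse_singleton, List.singleton_append,
      List.map_eq_cons_iff] at h
    obtain ⟨m, l', rfl, rfl, h⟩ := h
    have h' : ∀ x ∈ l', x.1 < m.1 := fun x hx => by
      have : x.1 ∈ (List.range m.1).reverse := h ▸ List.mem_map_of_mem hx
      simpa using this
    have h'' : (l'.filter fun x => decide (m.1 ≤ x.1) && decide (x.1 < m.1 + 1)) = [] := by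
      rw [List.filter_eq_nil_iff]
      intro x hx
      have := h' x hx
      simp; omega
    rw [List.filter_cons_of_pos (by simp), Nat.add_sub_cancel, h'']; rfl

theorem filter_all {l : List (ℕ × Data)} {r : ℕ} (h : l.map Prod.fst = (List.range r).reverse) :
    (l.filter fun m => decide (0 ≤ m.1) && decide (m.1 < r)) = l := by
  rw [List.filter_eq_self]
  intro x hx
  have : x.1 ∈ (List.range r).reverse := h ▸ List.mem_map_of_mem hx
  simpa using this

/-- The present states of the initial validators. -/
def packStates (n : ℕ) (w : World) : Data :=
  .ofList ((List.range n).map fun i => (w.loc (.node i)).state)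

/-- The messages sent by the initial validators. -/
def packHistories (n : ℕ) (w : World) : Data :=
  .ofList ((List.range n).map fun i => .ofList ((w.info i).sent.map Prod.snd))

section Simulation

variable {P : Protocol} {a b : Polynomial ℕ} {κ : ℕ} (ω : Coins P (attack P a b) κ)

theorem N_attack : (session P (attack P a b) κ ω).N = P.committee + P.committee := by
  change P.committee + (attack P a b).candidates.eval κ = _
  simp [attack]

theorem K_attack : (session P (attack P a b) κ ω).K = 2 := by
  change (attack P a b).clients.eval κ = 2
  simp [attack]

theorem corrupt_attack_eq (P : Protocol) (a b : Polynomial ℕ) (κ i : ℕ) :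
    (((attack P a b).corrupt.eval (.ofNat κ)).nth i).flag = decide (i < P.committee) := by
  change (((Prog.const _).eval _).nth i).flag = _
  rw [Prog.eval_const, Data.nth, Data.toList_ofList, List.getD_eq_getElem?_getD,
    List.getElem?_replicate]
  split_ifs with h <;> simp [h]

theorem corrupt_attack (i : ℕ) :
    (session P (attack P a b) κ ω).corrupt i = decide (i < P.committee) :=
  corrupt_attack_eq P a b κ i

/-- The simulated execution `c`. -/
noncomputable abbrev simSession (c : Fin 2) : Session := session P (env P a b) κ (simCoins c ω)

/-- The world of the simulated execution `c` before slot `r`. -/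
noncomputable def simWorld (c : Fin 2) (r : ℕ) : World := worldAt P (env P a b) κ (simCoins c ω) r

/-- The coins of the parties in the simulated execution `c`. -/
noncomputable def simPartyCoins (c : Fin 2) (r : Fin ((attack P a b).slots.eval κ)) : Party → Data :=
  partyCoins P (env P a b) κ (simCoins c ω) r

/-- The orders of the environment in the simulated execution `c`. -/
noncomputable def simOrders (c : Fin 2) (r : Fin ((attack P a b).slots.eval κ)) : Data :=
  envOrders (simCoins c ω) r

/-- What the code of `p` is given in the simulated execution `c`. -/
noncomputable def simInput (c : Fin 2) (r : Fin ((attack P a b).slots.eval κ)) (p : Party) : Data :=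
  (simSession ω c).stepInput r (simWorld ω c r) (simOrders ω c r) (simPartyCoins ω c r p) p

theorem cursor_sim (c : Fin 2) (r : Fin ((attack P a b).slots.eval κ)) (p : Party) (j : ℕ) :
    (simSession ω c).cursor r (simWorld ω c r) (simOrders ω c r) p j =
      max (((simWorld ω c r).loc p).cursor j) r :=
  cursor_envOrders (simCoins c ω) r _ p j

theorem inputs_sim (c : Fin 2) (r : Fin ((attack P a b).slots.eval κ)) (i : ℕ) :
    inputs (simOrders ω c r) (.node i) =
      if i < P.committee then
        (if a.eval κ ≤ r then [withdrawTx i] else []) ++ [payTx (.ofBits (simPayload c ω r))]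
      else if i < P.committee + P.committee ∧ a.eval κ ≤ r then [stakeTx i] else [] :=
  inputs_envOrders (simCoins c ω) r i

theorem invariant_sim (c : Fin 2) (r : Fin ((attack P a b).slots.eval κ)) :
    EnvInvariant P a b κ r (simWorld ω c r) :=
  envInvariant (simCoins c ω) (Nat.le_of_lt r.2)

theorem received_sim (c : Fin 2) (r : Fin ((attack P a b).slots.eval κ)) (p : Party) (j : ℕ) :
    (simSession ω c).received r (simWorld ω c r) (simOrders ω c r) p j =
    (((simWorld ω c r).info j).sent.filter fun m =>
      decide (((simWorld ω c r).loc p).cursor j ≤ m.1) &&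
      decide (m.1 < max (((simWorld ω c r).loc p).cursor j) r)).map Prod.snd := by
  have h : seized (simWorld ω c r) (simOrders ω c r) j = ((simWorld ω c r).info j).seized :=
    seized_envOrders (simCoins c ω) r _ j
  rw [received, corrupt_env, h, (invariant_sim ω c r).seized, cursor_sim]
  rfl

theorem simPartyCoins_candidate (c : Fin 2) (r : Fin ((attack P a b).slots.eval κ)) {j : ℕ}
    (hj : P.committee ≤ j) :
    simPartyCoins ω c r (.node j) = partyCoins P (attack P a b) κ ω r (.node j) := by
  by_cases h : j < (attack P a b).numNodes P κ
  · have h' : ((simCoins c ω).2 r).1 ⟨j, h⟩ = (ω.2 r).1 ⟨j, h⟩ := dif_neg hj.not_gt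
    simp only [partyCoins, dif_pos h]
    exact (dif_pos (c := j < (env P a b).numNodes P κ) h).trans
      (congrArg (Data.ofBits (k := P.coinBits.eval κ)) h')
  · simp only [partyCoins, dif_neg h]
    exact dif_neg (c := j < (env P a b).numNodes P κ) h

theorem nth_coins_sim_validator (c : Fin 2) (r : Fin ((attack P a b).slots.eval κ)) {i : ℕ}
    (hi : i < P.committee) :
    (attackerCoins P (attack P a b) κ ω r).nth (c * P.committee + i + 4) =
      simPartyCoins ω c r (.node i) := by
  rw [nth_attackerCoins _ _ _ (coinIndex_lt c hi)]
  have hN : i < (env P a b).numNodes P κ := hi.trans_le (Nat.le_add_right _ _)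
  have h : ((simCoins c ω).2 r).1 ⟨i, hN⟩ =
      (ω.2 r).2.2 ⟨c * P.committee + i + 4, coinIndex_lt c hi⟩ := dif_pos hi
  symm
  exact (dif_pos (c := i < (env P a b).numNodes P κ) hN).trans
    (congrArg (Data.ofBits (k := P.coinBits.eval κ)) h)

theorem nth_coins_sim_payload (c : Fin 2) (r : Fin ((attack P a b).slots.eval κ)) :
    (attackerCoins P (attack P a b) κ ω r).nth (c + 2) = .ofBits (simPayload c ω r) := by
  fin_cases c
  · exact nth_attackerCoins _ _ _ (show 2 < (attack P a b).blocks from Nat.lt_add_left _ (by decide))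
  · exact nth_attackerCoins _ _ _ (show 3 < (attack P a b).blocks from Nat.lt_add_left _ (by decide))

theorem len_attack_timer_zero (r : Fin ((attack P a b).slots.eval κ)) :
    ((attackerCoins P _ κ ω r).nth 0).len = a.eval κ := by
  rw [nth_attackerCoins _ _ _ (show 0 < (attack P a b).blocks from Nat.succ_pos _), Data.len_ofBits]
  rfl

theorem len_attack_timer_one (r : Fin ((attack P a b).slots.eval κ)) :
    ((attackerCoins P _ κ ω r).nth 1).len = a.eval κ + b.eval κ := by
  rw [nth_attackerCoins _ _ _ (show 1 < (attack P a b).blocks from Nat.lt_add_left _ (by decide)),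
    Data.len_ofBits]
  exact Polynomial.eval_add

/-- The state of the attacker before slot `r`. -/
noncomputable def attackState (r : ℕ) : Data :=
  if r = 0 then .leaf else
    .ofList [packStates P.committee (simWorld ω 0 r), packHistories P.committee (simWorld ω 0 r),
      if r ≤ a.eval κ then packStates P.committee (simWorld ω 1 r) else .leaf,
      if r ≤ a.eval κ then packHistories P.committee (simWorld ω 1 r) else .leaf]

/-- The course of the attack, up to slot `r`. -/
structure AttackInvariant (r : ℕ) (w : World) : Prop where
  advState : w.advState = attackState ω r
  seized : ∀ i, (w.info i).seized = false
  sent : ∀ i < P.committee, (w.info i).sent = []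
  left : ∀ i < P.committee, (w.info i).left = false
  loc : ∀ j, P.committee ≤ j → w.loc (.node j) = (simWorld ω 0 r).loc (.node j)
  info : ∀ j, P.committee ≤ j → w.info j = (simWorld ω 0 r).info j
  client_zero : r ≤ a.eval κ →
    w.loc (.client 0) = { state := .leaf, cursor := fun _ => 0, log := [], time := 0 }
  client_zero_log : a.eval κ < r → earlyEntry (simCoins 1 ω) ∈ (w.loc (.client 0)).log
  client_one : r ≤ a.eval κ + b.eval κ →
    w.loc (.client 1) = { state := .leaf, cursor := fun _ => 0, log := [], time := 0 }
  client_one_log : a.eval κ + b.eval κ < r →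
    (w.loc (.client 1)).log = [lastEntry (simCoins 0 ω)]

variable (r : Fin ((attack P a b).slots.eval κ))

/-- What the attacker is given in slot `r`. -/
noncomputable def attackInput : Data :=
  (session P (attack P a b) κ ω).advInput r (worldAt P (attack P a b) κ ω r)
    (attackerCoins P (attack P a b) κ ω r)

theorem eval_due_zero :
    (Prog.due (.coin 0)).eval (attackInput ω r) = .ofBool (decide (a.eval κ ≤ r)) := by
  rw [Prog.eval_due, Prog.eval_coin, attackInput, advInput_coins, len_attack_timer_zero,
    advInput_slot, Data.len_ofNat]

theorem eval_due_one :
    (Prog.due (.coin 1)).eval (attackInput ω r) =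
      .ofBool (decide (a.eval κ + b.eval κ ≤ r)) := by
  rw [Prog.eval_due, Prog.eval_coin, attackInput, advInput_coins, len_attack_timer_one,
    advInput_slot, Data.len_ofNat]

theorem eval_overdue_zero :
    (Prog.due (.pair .nil (.coin 0))).eval (attackInput ω r) =
      .ofBool (decide (a.eval κ < r)) := by
  rw [Prog.eval_due, Prog.eval, Prog.eval_coin, Data.len_node, attackInput, advInput_coins,
    len_attack_timer_zero, advInput_slot, Data.len_ofNat]
  rfl

theorem nth_packStates {n i : ℕ} (hi : i < n) (w : World) :
    (packStates n w).nth i = (w.loc (.node i)).state := by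
  rw [packStates, Data.nth_ofList_map_range, if_pos hi]

theorem nth_packHistories {n i : ℕ} (hi : i < n) (w : World) :
    (packHistories n w).nth i = .ofList ((w.info i).sent.map Prod.snd) := by
  rw [packHistories, Data.nth_ofList_map_range, if_pos hi]

variable {ω r}
variable (h : AttackInvariant ω r (worldAt P (attack P a b) κ ω r))
include h

theorem eval_history {c : Fin 2} (hc : c = 0 ∨ r ≤ a.eval κ) {i : ℕ} (hi : i < P.committee) :
    (Sim.history c i).eval (attackInput ω r) =
      .ofList (((simWorld ω c r).info i).sent.map Prod.snd) := by
  simp only [Sim.history, Prog.eval, Prog.eval_arg, attackInput, advInput_state, h.advState,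
    attackState]
  by_cases h0 : (r : ℕ) = 0
  · rw [h0]
    simp [simWorld, worldAt_zero, init]
  · simp only [h0, if_false]
    fin_cases c
    · simpa using nth_packHistories hi _
    · have : r ≤ a.eval κ := by simpa using hc
      simpa [this] using nth_packHistories hi _

theorem eval_latest {c : Fin 2} (hc : c = 0 ∨ r ≤ a.eval κ) {i : ℕ} (hi : i < P.committee) :
    (Sim.latest c i).eval (attackInput ω r) =
      .ofList ((((simWorld ω c r).info i).sent.take 1).map Prod.snd) := by
  simp only [Sim.latest, Prog.eval, eval_history h hc hi, Prog.eval_list, List.map_cons,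
    List.map_nil]
  cases ((simWorld ω c r).info i).sent <;> simp

theorem eval_state {c : Fin 2} (hc : c = 0 ∨ r ≤ a.eval κ) {i : ℕ} (hi : i < P.committee) :
    (Sim.state c i).eval (attackInput ω r) = ((simWorld ω c r).loc (.node i)).state := by
  simp only [Sim.state, Prog.eval, Prog.eval_arg, attackInput, advInput_state, h.advState,
    attackState, advInput_secrets]
  by_cases h0 : (r : ℕ) = 0
  · have hN : i < P.committee + P.committee := by omega
    rw [h0]
    simp only [if_true, Data.flag_leaf, Bool.false_eq_true, if_false, perNode,
      Data.nth_ofList_map_range, N_attack, hN, corrupt_attack, hi, decide_true]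
    rfl
  · simp only [h0, if_false, Data.ofList_cons, Data.flag_node, if_true]
    fin_cases c
    · simpa using nth_packStates hi _
    · have : r ≤ a.eval κ := by simpa using hc
      simpa [this] using nth_packStates hi _

theorem eval_inbox {c : Fin 2} (hc : c = 0 ∨ r < a.eval κ) {i : ℕ} (hi : i < P.committee) :
    (Sim.inbox P.committee c).eval (attackInput ω r) =
      (simSession ω c).inbox r (simWorld ω c r) (simOrders ω c r) (.node i) := by
  have hE := invariant_sim ω c r
  rw [Sim.inbox, Prog.eval_list, inbox, perNode, N_env, List.map_map]
  refine congrArg Data.ofList (List.map_congr_left fun j hj => ?_)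
  have hj' : j < P.committee + P.committee := List.mem_range.1 hj
  have hcur : ∀ j, ((simWorld ω c r).loc (.node i)).cursor j = r - 1 := fun j => by
    rw [hE.cursor i (by omega), if_pos (.inl hi)]
  have hmax : max ((r : ℕ) - 1) r = r := by omega
  rw [received_sim, hcur, hmax]
  simp only [Function.comp_apply]
  split_ifs with h1 h2
  · rw [eval_latest h (hc.imp_right le_of_lt) h1, filter_latest (hE.sent j h1)]
  · have hc0 : c = 0 := Fin.ext h2
    subst hc0
    simp only [Prog.eval, Prog.eval_arg, attackInput, advInput_messages, perNode, N_attack,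
      Data.nth_ofList_map_range, hj', if_true, h.info j (not_lt.1 h1)]
    congr 3
    funext m
    rw [← Bool.decide_and, decide_eq_decide]
    omega
  · have hc1 : r < a.eval κ := hc.resolve_left fun h => h2 (congrArg Fin.val h)
    rw [hE.fresh hc1.le j (not_lt.1 h1)]
    rfl

theorem eval_input {c : Fin 2} (hc : c = 0 ∨ r < a.eval κ) {i : ℕ} (hi : i < P.committee) :
    (Sim.input P.committee c i).eval (attackInput ω r) = simInput ω c r (.node i) := by
  have hin : (Sim.inputs c i).eval (attackInput ω r) =
      .ofList (inputs (simOrders ω c r) (.node i)) := by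
    rw [inputs_sim, if_pos hi, ← nth_coins_sim_payload, Sim.inputs]
    have h1 : (attackInput ω r).nth 7 = attackerCoins P (attack P a b) κ ω r := advInput_coins ..
    simp only [Prog.eval, eval_due_zero, Data.flag_ofBool, decide_eq_true_eq, Prog.eval_list,
      List.map_cons, List.map_nil, Prog.eval_const, Prog.eval_coin, h1, payTx]
    split_ifs <;> rfl
  rw [simInput, stepInput, ← nth_coins_sim_validator ω c r hi]
  simp only [Sim.input, Prog.eval_list, List.map_cons, List.map_nil, hin, eval_inbox h hc hi,
    eval_state h (hc.imp_right le_of_lt) hi, Prog.eval_arg, Prog.eval_const, Prog.eval_coin]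
  simp only [attackInput, advInput_param, advInput_pks, advInput_slot, advInput_coins]
  rfl

end Simulation


/-! ### The attack: its course -/

section Attack

variable {P : Protocol} {a b : Polynomial ℕ} {κ : ℕ} (ω : Coins P (attack P a b) κ)
variable (r : Fin ((attack P a b).slots.eval κ))

theorem loc_sim_succ (c : Fin 2) {i : ℕ} (hi : Participates P (a.eval κ) r i) :
    (simWorld ω c (r + 1)).loc (.node i) =
      (simSession ω c).stepLocal r (simWorld ω c r) (simOrders ω c r)
        (simPartyCoins ω c r (.node i)) (.node i) (!((simWorld ω c r).info i).left) :=
  loc_env_node_succ (simCoins c ω) r hi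

theorem info_sim_succ (c : Fin 2) {i : ℕ} (hi : Participates P (a.eval κ) r i) :
    (simWorld ω c (r + 1)).info i =
      (simSession ω c).stepInfo r (simWorld ω c r) (simOrders ω c r)
        (simPartyCoins ω c r (.node i)) i :=
  info_env_succ (simCoins c ω) r hi

theorem runs_sim (c : Fin 2) (i : ℕ) :
    (simSession ω c).runs (simWorld ω c r) (simOrders ω c r) i =
      decide (i < P.committee ∨ i < P.committee + P.committee ∧ a.eval κ ≤ r) :=
  runs_envOrders (simCoins c ω) r (invariant_sim ω c r) i

theorem simWorld_succ (c : Fin 2) : simWorld ω c (r + 1) =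
    (simSession ω c).next r (simWorld ω c r) (simPartyCoins ω c r)
      (attackerCoins P (env P a b) κ (simCoins c ω) r) :=
  worldAt_env_succ (simCoins c ω) r

/-- The orders of the attacker in slot `r`. -/
noncomputable def attackOrders : Data := (attack P a b).step.eval (attackInput ω r)

variable {ω r}
variable (h : AttackInvariant ω r (worldAt P (attack P a b) κ ω r))
include h

theorem eval_simulate : (Sim.simulate P.committee P.step).eval (attackInput ω r) =
    .ofList [attackInput ω r,
      .ofList ((List.range P.committee).map fun i => P.step.eval (simInput ω 0 r (.node i))),
      .ofList ((List.range P.committee).map fun i =>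
        if a.eval κ ≤ r then .leaf else P.step.eval (simInput ω 1 r (.node i)))] := by
  simp only [Sim.simulate, Prog.eval_list, List.map_cons, List.map_nil, List.map_map]
  congr 3
  · refine congrArg _ (List.map_congr_left fun i hi => ?_)
    exact congrArg P.step.eval (eval_input h (c := 0) (.inl rfl) (List.mem_range.1 hi))
  · congr 2
    refine List.map_congr_left fun i hi => ?_
    simp only [Function.comp_apply, Sim.early, Prog.eval, eval_due_zero, Data.flag_ofBool,
      decide_eq_true_eq]
    split_ifs with h1
    · rfl
    · exact congrArg P.step.eval
        (eval_input h (c := 1) (.inr (not_le.1 h1)) (List.mem_range.1 hi))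

theorem eval_mail {j : ℕ} (hj : j < P.committee) :
    (Sim.mail j).eval (attackInput ω r) = .ofList ((((simWorld ω 0 r).info j).sent.filter fun m =>
      decide ((if a.eval κ < r then (r : ℕ) - 1 else 0) ≤ m.1) && decide (m.1 < (r : ℕ))).map
        Prod.snd) := by
  have hs := (invariant_sim ω 0 r).sent j hj
  simp only [Sim.mail, Prog.eval, eval_overdue_zero, Data.flag_ofBool, decide_eq_true_eq]
  split_ifs with h1
  · rw [filter_latest hs]; exact eval_latest h (c := 0) (.inl rfl) hj
  · rw [filter_all hs]; exact eval_history h (c := 0) (.inl rfl) hj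

theorem nodeOrder_attack (i : ℕ) : nodeOrder (attackOrders ω r) i =
    if P.committee ≤ i ∧ i < P.committee + P.committee then
      .ofList [.ofBool (decide (a.eval κ ≤ r)), .leaf, .leaf,
        .ofList ((List.range P.committee).map fun j =>
          .node .leaf ((Sim.mail j).eval (attackInput ω r)))]
    else .leaf := by
  have : nodeOrder (attackOrders ω r) i =
      (Data.ofList ((List.range (P.committee + P.committee)).map fun i =>
        Prog.eval (if i < P.committee then .nil else .comp (Sim.candidateOrder P.committee) (.arg 0))
          ((Sim.simulate P.committee P.step).eval (attackInput ω r)))).nth i := by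
    simp [nodeOrder, attackOrders, attack, Prog.eval, Sim.conclude, Function.comp_def]
  rw [this, Data.nth_ofList_map_range, eval_simulate h]
  by_cases h1 : i < P.committee
  · simp [h1, Nat.not_le.2 h1, Prog.eval]
  · by_cases h2 : i < P.committee + P.committee
    · simp [h1, h2, not_lt.1 h1, Prog.eval, Sim.candidateOrder, eval_due_zero, Function.comp_def]
    · simp [h2]

theorem clientOrder_attack_zero : clientOrder (attackOrders ω r) 0 =
    .ofList [.ofBool (decide (a.eval κ ≤ r)), .ofList ((List.range P.committee).map fun j =>
      .node .leaf ((Sim.history 1 j).eval (attackInput ω r)))] := by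
  simp [clientOrder, attackOrders, attack, Prog.eval, Sim.conclude, Function.comp_def,
    eval_simulate h, Sim.clientOrder, eval_due_zero]

theorem clientOrder_attack_one : clientOrder (attackOrders ω r) 1 =
    .ofList [.ofBool (decide (a.eval κ + b.eval κ ≤ r)),
      .ofList ((List.range P.committee).map fun j =>
        .node .leaf ((Sim.history 0 j).eval (attackInput ω r)))] := by
  simp [clientOrder, attackOrders, attack, Prog.eval, Sim.conclude, Function.comp_def,
    eval_simulate h, Sim.clientOrder, eval_due_one]

theorem advState_attack : (attackOrders ω r).nth 0 = attackState ω (r + 1) := by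
  have hs : ∀ c : Fin 2, packStates P.committee (simWorld ω c (r + 1)) =
      .ofList ((List.range P.committee).map fun i =>
        (P.step.eval (simInput ω c r (.node i))).nth 0) := fun c => by
    refine congrArg _ (List.map_congr_left fun i hi => ?_)
    rw [loc_sim_succ ω r c (.inl (List.mem_range.1 hi))]
    rfl
  have hh : ∀ c : Fin 2, c = 0 ∨ r ≤ a.eval κ →
      packHistories P.committee (simWorld ω c (r + 1)) =
      .ofList ((List.range P.committee).map fun i =>
        .node ((P.step.eval (simInput ω c r (.node i))).nth 1)
          ((Sim.history c i).eval (attackInput ω r))) := fun c hc => by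
    refine congrArg _ (List.map_congr_left fun i hi => ?_)
    rw [info_sim_succ ω r c (.inl (List.mem_range.1 hi)),
      eval_history h hc (List.mem_range.1 hi)]
    rfl
  have hmap : ∀ {f g : ℕ → Data}, (∀ i < P.committee, f i = g i) →
      Data.ofList ((List.range P.committee).map f) = .ofList ((List.range P.committee).map g) :=
    fun hfg => congrArg _ (List.map_congr_left fun i hi => hfg i (List.mem_range.1 hi))
  have hz := eval_simulate h
  simp only [attackOrders, attack, Prog.eval, Sim.conclude, Prog.eval_list, List.map_cons,
    List.map_nil, List.map_map, Data.ofList_cons, Data.nth_node_zero, hz, Sim.earlyAfter,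
    Prog.eval_arg, eval_due_zero, Data.flag_ofBool, decide_eq_true_eq]
  rw [attackState, if_neg (Nat.succ_ne_zero _)]
  simp only [Data.ofList_cons, Data.ofList_nil]
  congr 1
  · rw [hs]
    exact hmap fun i hi => by
      simp [Sim.newState, Prog.eval, Data.nth_ofList_map_range, hi]
  · congr 1
    · rw [hh 0 (.inl rfl)]
      exact hmap fun i hi => by
        simp [Sim.newHistory, Prog.eval, Data.nth_ofList_map_range, hi]
    · by_cases h0 : a.eval κ ≤ r
      · simp [h0, Nat.not_le.2 (Nat.lt_succ_of_le h0)]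
      · have h1 : (r : ℕ) + 1 ≤ a.eval κ := by omega
        simp only [h0, h1, if_false, if_true]
        congr 1
        · rw [hs]
          exact hmap fun i hi => by
            simp [Sim.newState, Prog.eval, Data.nth_ofList_map_range, hi]
        · rw [hh 1 (.inr (by omega))]
          congr 1
          exact hmap fun i hi => by
            simp [Sim.newHistory, Prog.eval, Data.nth_ofList_map_range, hi]

omit h in
theorem cursor_attack (p : Party) (j : ℕ)
    (hnet : ((netOrder (attackOrders ω r) p).nth j).fst = .leaf) :
    (session P (attack P a b) κ ω).cursor r (worldAt P (attack P a b) κ ω r) (attackOrders ω r) p j =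
      max (((worldAt P (attack P a b) κ ω r).loc p).cursor j) r := by
  simp [Session.cursor, hnet]

theorem seized_attack (i : ℕ) :
    seized (worldAt P (attack P a b) κ ω r) (attackOrders ω r) i = false := by
  rw [seized, h.seized, nodeOrder_attack h]
  split_ifs <;> simp

/-- A party that gets from the attacker what it gets from the initial validators in the simulated
execution receives the same messages as there. -/
theorem inbox_attack {c : Fin 2} {p : Party}
    (hcur : ((worldAt P (attack P a b) κ ω r).loc p).cursor = ((simWorld ω c r).loc p).cursor)
    (hnet : ∀ j < P.committee, (netOrder (attackOrders ω r) p).nth j = .node .leaf (.ofList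
      ((((simWorld ω c r).info j).sent.filter fun m =>
        decide (((simWorld ω c r).loc p).cursor j ≤ m.1) &&
        decide (m.1 < max (((simWorld ω c r).loc p).cursor j) r)).map Prod.snd)))
    (hnet' : ∀ j, P.committee ≤ j → (netOrder (attackOrders ω r) p).nth j = .leaf)
    (hsent : ∀ j, P.committee ≤ j → ((worldAt P (attack P a b) κ ω r).info j).sent =
      ((simWorld ω c r).info j).sent) :
    (session P (attack P a b) κ ω).inbox r (worldAt P (attack P a b) κ ω r) (attackOrders ω r) p =
      (simSession ω c).inbox r (simWorld ω c r) (simOrders ω c r) p := by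
  rw [inbox, inbox, perNode, perNode, N_attack, N_env]
  refine congrArg _ (List.map_congr_left fun j _ => congrArg _ ?_)
  rw [received_sim, received, seized_attack h, corrupt_attack]
  rcases lt_or_ge j P.committee with hj | hj
  · simp [hj, hnet j hj, h.sent j hj]
  · rw [cursor_attack p j (by rw [hnet' j hj]; rfl), hsent j hj, hcur]
    simp [Nat.not_lt.2 hj]

theorem stepLocal_attack {c : Fin 2} {p : Party} (visible : Bool)
    (hloc : (worldAt P (attack P a b) κ ω r).loc p = (simWorld ω c r).loc p)
    (hnet : ∀ j < P.committee, (netOrder (attackOrders ω r) p).nth j = .node .leaf (.ofList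
      ((((simWorld ω c r).info j).sent.filter fun m =>
        decide (((simWorld ω c r).loc p).cursor j ≤ m.1) &&
        decide (m.1 < max (((simWorld ω c r).loc p).cursor j) r)).map Prod.snd)))
    (hnet' : ∀ j, P.committee ≤ j → (netOrder (attackOrders ω r) p).nth j = .leaf)
    (hsent : ∀ j, P.committee ≤ j → ((worldAt P (attack P a b) κ ω r).info j).sent =
      ((simWorld ω c r).info j).sent)
    (hin : inputs (attackOrders ω r) p = inputs (simOrders ω c r) p)
    (hcoins : partyCoins P (attack P a b) κ ω r p = simPartyCoins ω c r p) :
    (session P (attack P a b) κ ω).stepInput r (worldAt P (attack P a b) κ ω r) (attackOrders ω r)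
        (partyCoins P (attack P a b) κ ω r p) p = simInput ω c r p ∧
    (session P (attack P a b) κ ω).stepLocal r (worldAt P (attack P a b) κ ω r) (attackOrders ω r)
        (partyCoins P (attack P a b) κ ω r p) p visible =
      (simSession ω c).stepLocal r (simWorld ω c r) (simOrders ω c r)
        (simPartyCoins ω c r p) p visible := by
  have hi := inbox_attack h (congrArg Local.cursor hloc) hnet hnet' hsent
  have hx : (session P (attack P a b) κ ω).stepInput r (worldAt P (attack P a b) κ ω r)
      (attackOrders ω r) (partyCoins P (attack P a b) κ ω r p) p = simInput ω c r p := by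
    rw [stepInput, simInput, stepInput, hi, hin, hcoins, hloc]
    rfl
  have hc : (session P (attack P a b) κ ω).cursor r (worldAt P (attack P a b) κ ω r)
      (attackOrders ω r) p =
      (simSession ω c).cursor r (simWorld ω c r) (simOrders ω c r) p := by
    funext j
    rw [cursor_sim, cursor_attack, hloc]
    rcases lt_or_ge j P.committee with hj | hj
    · rw [hnet j hj]; rfl
    · rw [hnet' j hj]; rfl
  refine ⟨hx, ?_⟩
  simp only [stepLocal, stepOutput, hx, hc, hi, hloc]
  rfl

end Attack


section Attack

variable {P : Protocol} {a b : Polynomial ℕ} {κ : ℕ} (ω : Coins P (attack P a b) κ)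
variable (r : Fin ((attack P a b).slots.eval κ))

theorem loc_attack_node_succ (i : ℕ) :
    (worldAt P (attack P a b) κ ω (r + 1)).loc (.node i) =
      if (session P (attack P a b) κ ω).runs (worldAt P (attack P a b) κ ω r) (attackOrders ω r) i
      then (session P (attack P a b) κ ω).stepLocal r (worldAt P (attack P a b) κ ω r)
        (attackOrders ω r) (partyCoins P (attack P a b) κ ω r (.node i)) (.node i)
        (!((worldAt P (attack P a b) κ ω r).info i).left)
      else (worldAt P (attack P a b) κ ω r).loc (.node i) := by
  rw [worldAt_succ P _ κ ω r.2]; rfl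

theorem loc_attack_client_succ (q : ℕ) :
    (worldAt P (attack P a b) κ ω (r + 1)).loc (.client q) =
      if (session P (attack P a b) κ ω).online (attackOrders ω r) q
      then (session P (attack P a b) κ ω).stepLocal r (worldAt P (attack P a b) κ ω r)
        (attackOrders ω r) (partyCoins P (attack P a b) κ ω r (.client q)) (.client q) true
      else (worldAt P (attack P a b) κ ω r).loc (.client q) := by
  rw [worldAt_succ P _ κ ω r.2]; rfl

theorem info_attack_succ (i : ℕ) :
    (worldAt P (attack P a b) κ ω (r + 1)).info i =
      if (session P (attack P a b) κ ω).runs (worldAt P (attack P a b) κ ω r) (attackOrders ω r) i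
      then (session P (attack P a b) κ ω).stepInfo r (worldAt P (attack P a b) κ ω r)
        (attackOrders ω r) (partyCoins P (attack P a b) κ ω r (.node i)) i
      else { (worldAt P (attack P a b) κ ω r).info i with
        joined := joined (worldAt P (attack P a b) κ ω r) (attackOrders ω r) i
        seized := seized (worldAt P (attack P a b) κ ω r) (attackOrders ω r) i } := by
  rw [worldAt_succ P _ κ ω r.2]; rfl

theorem loc_sim_succ_of_not (c : Fin 2) {i : ℕ} (hi : ¬ Participates P (a.eval κ) r i) :
    (simWorld ω c (r + 1)).loc (.node i) = (simWorld ω c r).loc (.node i) := by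
  have hr := runs_sim ω r c i
  rw [decide_eq_false (p := i < P.committee ∨ _) hi] at hr
  rw [simWorld_succ]
  exact if_neg (ne_true_of_eq_false hr)

theorem info_sim_succ_of_not (c : Fin 2) {i : ℕ} (hi : ¬ Participates P (a.eval κ) r i) :
    (simWorld ω c (r + 1)).info i = { (simWorld ω c r).info i with
      joined := joined (simWorld ω c r) (simOrders ω c r) i
      seized := seized (simWorld ω c r) (simOrders ω c r) i } := by
  have hr := runs_sim ω r c i
  rw [decide_eq_false (p := i < P.committee ∨ _) hi] at hr
  rw [simWorld_succ]
  exact if_neg (ne_true_of_eq_false hr)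

theorem joined_sim (c : Fin 2) (i : ℕ) : joined (simWorld ω c r) (simOrders ω c r) i =
    (((simWorld ω c r).info i).joined ||
      decide (P.committee ≤ i ∧ i < P.committee + P.committee ∧ a.eval κ ≤ r)) :=
  joined_envOrders (simCoins c ω) r _ i

theorem asked_sim (c : Fin 2) (i : ℕ) : ((nodeOrder (simOrders ω c r) i).nth 1).flag =
    decide (i < P.committee ∧ a.eval κ ≤ r) :=
  asked_envOrders (simCoins c ω) r i

theorem seized_sim (c : Fin 2) (i : ℕ) : seized (simWorld ω c r) (simOrders ω c r) i = false :=
  (seized_envOrders (simCoins c ω) r _ i).trans ((invariant_sim ω c r).seized i)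

variable {ω r}
variable (h : AttackInvariant ω r (worldAt P (attack P a b) κ ω r))
include h

theorem joined_attack {i : ℕ} (hi : P.committee ≤ i) :
    joined (worldAt P (attack P a b) κ ω r) (attackOrders ω r) i =
      joined (simWorld ω 0 r) (simOrders ω 0 r) i := by
  rw [joined_sim, joined, h.info i hi, nodeOrder_attack h]
  by_cases h1 : i < P.committee + P.committee <;> simp [hi, h1]

theorem runs_attack (i : ℕ) :
    (session P (attack P a b) κ ω).runs (worldAt P (attack P a b) κ ω r) (attackOrders ω r) i =
      decide (P.committee ≤ i ∧ i < P.committee + P.committee ∧ a.eval κ ≤ r) := by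
  rw [runs, N_attack, corrupt_attack, seized_attack h]
  rcases lt_or_ge i P.committee with hi | hi
  · simp [hi, Nat.not_le.2 hi]
  · have hj := (invariant_sim ω 0 r).joined i
    rw [joined_attack h hi, joined_sim, hj]
    simp only [← decide_not, ← Bool.decide_and, ← Bool.decide_or, Bool.not_false, Bool.and_true,
      decide_eq_decide]
    omega

theorem stepLocal_attack_candidate {i : ℕ} (hi : P.committee ≤ i)
    (hN : i < P.committee + P.committee) (h0 : a.eval κ ≤ r) (visible : Bool) :
    (session P (attack P a b) κ ω).stepInput r (worldAt P (attack P a b) κ ω r) (attackOrders ω r)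
        (partyCoins P (attack P a b) κ ω r (.node i)) (.node i) = simInput ω 0 r (.node i) ∧
    (session P (attack P a b) κ ω).stepLocal r (worldAt P (attack P a b) κ ω r) (attackOrders ω r)
        (partyCoins P (attack P a b) κ ω r (.node i)) (.node i) visible =
      (simSession ω 0).stepLocal r (simWorld ω 0 r) (simOrders ω 0 r)
        (simPartyCoins ω 0 r (.node i)) (.node i) visible := by
  have hnet : ∀ j, (netOrder (attackOrders ω r) (.node i)).nth j =
      if j < P.committee then .node .leaf ((Sim.mail j).eval (attackInput ω r)) else .leaf := by
    intro j
    rw [netOrder, nodeOrder_attack h, if_pos ⟨hi, hN⟩]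
    exact Data.nth_ofList_map_range _ _ _
  refine stepLocal_attack h visible (h.loc i hi) ?_ ?_ ?_ ?_
    (simPartyCoins_candidate ω 0 r hi).symm
  · intro j hj
    have hc := (invariant_sim ω 0 r).cursor i hN j
    simp only [Nat.not_lt.2 hi, false_or] at hc
    have hm : max (if a.eval κ < (r : ℕ) then (r : ℕ) - 1 else 0) r = r := by split_ifs <;> omega
    rw [hnet, if_pos hj, eval_mail h hj, hc, hm]
  · intro j hj
    rw [hnet, if_neg (not_lt.2 hj)]
  · intro j hj
    rw [h.info j hj]
  · rw [inputs_sim, inputs, tasks, nodeOrder_attack h]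
    simp [hi, hN, h0, Nat.not_lt.2 hi]

theorem stepLocal_attack_client_zero (h0 : a.eval κ = r) :
    (session P (attack P a b) κ ω).stepLocal r (worldAt P (attack P a b) κ ω r) (attackOrders ω r)
        (partyCoins P (attack P a b) κ ω r (.client 0)) (.client 0) true =
      (simSession ω 1).stepLocal r (simWorld ω 1 r) (simOrders ω 1 r)
        (simPartyCoins ω 1 r (.client 0)) (.client 0) true := by
  have hE := invariant_sim ω 1 r
  have hloc := hE.client_zero h0.ge
  have hnet : ∀ j, (netOrder (attackOrders ω r) (.client 0)).nth j =
      if j < P.committee then .node .leaf ((Sim.history 1 j).eval (attackInput ω r))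
      else .leaf := by
    intro j
    rw [netOrder, clientOrder_attack_zero h]
    exact Data.nth_ofList_map_range _ _ _
  refine (stepLocal_attack h true ((h.client_zero h0.ge).trans hloc.symm) ?_ ?_ ?_ rfl rfl).2
  · intro j hj
    rw [hnet, if_pos hj, hloc, Nat.max_eq_right (Nat.zero_le _), filter_all (hE.sent j hj)]
    exact congrArg _ (eval_history h (c := 1) (.inr h0.ge) hj)
  · intro j hj
    rw [hnet, if_neg (not_lt.2 hj)]
  · intro j hj
    rw [h.info j hj, hE.fresh h0.ge j hj, (invariant_sim ω 0 r).fresh h0.ge j hj]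

theorem stepLocal_attack_client_one (h0 : a.eval κ + b.eval κ = r) :
    (session P (attack P a b) κ ω).stepLocal r (worldAt P (attack P a b) κ ω r) (attackOrders ω r)
        (partyCoins P (attack P a b) κ ω r (.client 1)) (.client 1) true =
      (simSession ω 0).stepLocal r (simWorld ω 0 r) (simOrders ω 0 r)
        (simPartyCoins ω 0 r (.client 1)) (.client 1) true := by
  have hE := invariant_sim ω 0 r
  have hloc := hE.client_one h0.ge
  have hnet : ∀ j, (netOrder (attackOrders ω r) (.client 1)).nth j =
      if j < P.committee then .node .leaf ((Sim.history 0 j).eval (attackInput ω r))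
      else .leaf := by
    intro j
    rw [netOrder, clientOrder_attack_one h]
    exact Data.nth_ofList_map_range _ _ _
  refine (stepLocal_attack h true ((h.client_one h0.ge).trans hloc.symm) ?_ ?_ ?_ rfl rfl).2
  · intro j hj
    rw [hnet, if_pos hj, hloc, Nat.max_eq_right (Nat.zero_le _), filter_all (hE.sent j hj)]
    exact congrArg _ (eval_history h (c := 0) (.inl rfl) hj)
  · intro j hj
    rw [hnet, if_neg (not_lt.2 hj)]
  · intro j hj
    rw [h.info j hj]

theorem info_attack_candidate_succ {i : ℕ} (hi : P.committee ≤ i) :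
    (worldAt P (attack P a b) κ ω (r + 1)).info i = (simWorld ω 0 (r + 1)).info i := by
  rw [info_attack_succ, runs_attack h]
  split_ifs with h1
  · obtain ⟨-, hN, h0⟩ := of_decide_eq_true h1
    have hx := (stepLocal_attack_candidate h hi hN h0 true).1
    rw [info_sim_succ ω r 0 (.inr ⟨hN, h0⟩)]
    have hask := asked_sim ω r 0 i
    rw [decide_eq_false (by omega)] at hask
    have hask' : ((nodeOrder (attackOrders ω r) i).nth 1).flag = false := by
      rw [nodeOrder_attack h, if_pos ⟨hi, hN⟩]; rfl
    simp only [stepInfo, stepOutput, hx, h.info i hi, joined_attack h hi, seized_attack h,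
      seized_sim, hask, hask']
    rfl
  · rw [decide_eq_true_eq] at h1
    rw [info_sim_succ_of_not ω r 0 (fun h2 => h1 (by unfold Participates at h2; omega)), h.info i hi,
      joined_attack h hi, seized_attack h, seized_sim]

theorem loc_attack_candidate_succ {i : ℕ} (hi : P.committee ≤ i) :
    (worldAt P (attack P a b) κ ω (r + 1)).loc (.node i) = (simWorld ω 0 (r + 1)).loc (.node i) := by
  rw [loc_attack_node_succ, runs_attack h]
  split_ifs with h1
  · obtain ⟨-, hN, h0⟩ := of_decide_eq_true h1
    rw [loc_sim_succ ω r 0 (.inr ⟨hN, h0⟩), h.info i hi]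
    exact (stepLocal_attack_candidate h hi hN h0 _).2
  · rw [decide_eq_true_eq] at h1
    rw [loc_sim_succ_of_not ω r 0 (fun h2 => h1 (by unfold Participates at h2; omega)), h.loc i hi]

theorem info_attack_validator_succ {i : ℕ} (hi : i < P.committee) :
    ((worldAt P (attack P a b) κ ω (r + 1)).info i).sent = [] ∧
      ((worldAt P (attack P a b) κ ω (r + 1)).info i).left = false := by
  rw [info_attack_succ, runs_attack h, decide_eq_false (by omega)]
  exact ⟨h.sent i hi, h.left i hi⟩

theorem online_attack_zero :
    (session P (attack P a b) κ ω).online (attackOrders ω r) 0 = decide (a.eval κ ≤ r) := by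
  simp [online, K_attack, clientOrder_attack_zero h]

theorem online_attack_one :
    (session P (attack P a b) κ ω).online (attackOrders ω r) 1 =
      decide (a.eval κ + b.eval κ ≤ r) := by
  simp [online, K_attack, clientOrder_attack_one h]

theorem attackInvariant_succ :
    AttackInvariant ω (r + 1) (worldAt P (attack P a b) κ ω (r + 1)) where
  advState := by
    rw [← advState_attack h, worldAt_succ P _ κ ω r.2]; rfl
  seized i := by
    rw [worldAt_succ P _ κ ω r.2, next_seized]; exact seized_attack h i
  sent i hi := (info_attack_validator_succ h hi).1
  left i hi := (info_attack_validator_succ h hi).2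
  loc i hi := loc_attack_candidate_succ h hi
  info i hi := info_attack_candidate_succ h hi
  client_zero h0 := by
    rw [loc_attack_client_succ, online_attack_zero h, decide_eq_false (by omega)]
    exact h.client_zero (by omega)
  client_zero_log h0 := by
    rcases Nat.lt_or_ge (a.eval κ) r with h1 | h1
    · rw [worldAt_succ P _ κ ω r.2]
      exact log_subset_next _ _ _ _ _ _ (h.client_zero_log h1)
    · have h2 : a.eval κ = r := by omega
      rw [loc_attack_client_succ, online_attack_zero h, decide_eq_true h2.le, if_pos rfl,
        stepLocal_attack_client_zero h h2]
      have hr : r = earlySlot P a b κ := Fin.ext h2.symm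
      subst hr
      exact List.mem_cons_self
  client_one h0 := by
    rw [loc_attack_client_succ, online_attack_one h, decide_eq_false (by omega)]
    exact h.client_one (by omega)
  client_one_log h0 := by
    have hs : (r : ℕ) < a.eval κ + b.eval κ + 1 :=
      r.2.trans_eq (eval_slots_env (P := P))
    have h2 : a.eval κ + b.eval κ = r := by omega
    rw [loc_attack_client_succ, online_attack_one h, decide_eq_true h2.le, if_pos rfl,
      stepLocal_attack_client_one h h2]
    have hr : r = lastSlot P a b κ := Fin.ext h2.symm
    subst hr
    rw [stepLocal, if_pos rfl, (invariant_sim ω 0 (lastSlot P a b κ)).client_one le_rfl]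
    rfl

omit h in
theorem attackInvariant (ω : Coins P (attack P a b) κ) {r : ℕ}
    (hr : r ≤ (attack P a b).slots.eval κ) :
    AttackInvariant ω r (worldAt P (attack P a b) κ ω r) := by
  induction r with
  | zero =>
    constructor <;> simp [worldAt_zero, init, attackState, simWorld]
    · intro j _; rfl
    · intro j hj
      rfl
  | succ r ih => exact attackInvariant_succ (r := ⟨r, hr⟩) (ih (Nat.le_of_succ_le hr))

end Attack


/-! ### The attack: its running time -/

namespace Prog

theorem cost_list_le {l : List Prog} {x : Data} {k : ℕ} (h : ∀ p ∈ l, p.cost x ≤ k) :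
    (list l).cost x ≤ l.length * (1 + k) + (1 + x.size) := by
  induction l with
  | nil => simp [list, cost]
  | cons p l ih =>
    have h1 := h p (by simp)
    have h2 := ih fun q hq => h q (by simp [hq])
    simp only [list, cost, List.length_cons]
    rw [add_one_mul]
    omega

theorem cost_le_cost_list {l : List Prog} {p : Prog} (hp : p ∈ l) (x : Data) :
    p.cost x ≤ (list l).cost x := by
  induction l with
  | nil => simp at hp
  | cons q l ih =>
    simp only [list, cost]
    rcases List.mem_cons.1 hp with rfl | hp
    · omega
    · have := ih hp; omega

end Prog

section Attack

variable {P : Protocol} {a b : Polynomial ℕ} {κ : ℕ} (ω : Coins P (attack P a b) κ)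
variable (r : Fin ((attack P a b).slots.eval κ)) {G : ℕ}
  (hG : ∀ (ω : Coins P (env P a b) κ), ∀ r ≤ (env P a b).slots.eval κ,
    ∀ q, ((worldAt P (env P a b) κ ω r).loc q).time ≤ G)

include hG

theorem size_attackState_le :
    (attackState ω r).size ≤ 1 + 4 * (1 + (1 + P.committee * (1 + (1 + 2 * G)))) := by
  have hs : ∀ c : Fin 2, (packStates P.committee (simWorld ω c r)).size ≤
      1 + P.committee * (1 + (1 + 2 * G)) := fun c => by
    refine (Data.size_ofList_le (k := 1 + 2 * G) ?_).trans (by simp)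
    simp only [List.mem_map, List.mem_range, forall_exists_index, and_imp,
      forall_apply_eq_imp_iff₂]
    intro i hi
    have : ((simWorld ω c r).loc (.node i)).state.size ≤ G :=
      size_state_env_le (simCoins c ω) (hG _) hi r.2
    omega
  have hh : ∀ c : Fin 2, (packHistories P.committee (simWorld ω c r)).size ≤
      1 + P.committee * (1 + (1 + 2 * G)) := fun c => by
    refine (Data.size_ofList_le (k := 1 + 2 * G) ?_).trans (by simp)
    simp only [List.mem_map, List.mem_range, forall_exists_index, and_imp,
      forall_apply_eq_imp_iff₂]
    intro i hi
    have h1 := sent_size_le P _ κ (simCoins c ω) i r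
    have h2 := hG (simCoins c ω) r (Nat.le_of_lt r.2) (.node i)
    rw [Data.size_ofList, List.map_map]
    refine Nat.add_le_add_left (le_trans h1 (by omega)) 1
  have hl : Data.leaf.size ≤ 1 + P.committee * (1 + (1 + 2 * G)) := Nat.le_add_right _ _
  rw [attackState]
  split_ifs
  · exact Nat.le_add_right _ _
  all_goals
    refine (Data.size_ofList_le (k := 1 + P.committee * (1 + (1 + 2 * G))) ?_).trans (by simp)
    simp only [List.mem_cons, List.not_mem_nil, or_false, forall_eq_or_imp, forall_eq]
    simp only [hs, hh, hl, and_self]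

theorem size_attackInput_le : (attackInput ω r).size ≤
    1 + 8 * (1 + ((1 + κ * 2) + (1 + (attack P a b).slots.eval κ * 2) +
      (1 + 4 * (1 + (1 + P.committee * (1 + (1 + 2 * G))))) +
      (1 + (P.committee + P.committee + 4) *
        (1 + (1 + (a.eval κ + b.eval κ + κ + P.coinBits.eval κ) * 4))) +
      (1 + (P.committee + P.committee) * (1 + (1 + (1 + 2 * G)))))) := by
  have h := attackInvariant ω r.2.le
  have hN := N_attack ω
  refine (size_advInput_le (X := 1 + 2 * G) r.2.le ?_ ?_
    (h.advState ▸ size_attackState_le ω r hG) ?_ h.seized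
    (B := 1 + (P.committee + P.committee + 4) *
        (1 + (1 + (a.eval κ + b.eval κ + κ + P.coinBits.eval κ) * 4))) ?_).trans
    (by rw [hN]; rfl)
  · intro i _ hi
    rw [corrupt_attack, decide_eq_true_eq] at hi
    exact (size_secret_env_le (simCoins 0 ω) (hG _) hi).trans (by omega)
  · exact (size_pks_env_le (simCoins 0 ω) (hG _)).trans (by omega)
  · intro i _
    rcases lt_or_ge i P.committee with hi | hi
    · simp [h.sent i hi, Data.size]
    · rw [h.info i hi]
      refine (size_messages_le P _ κ (simCoins 0 ω) i r).trans ?_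
      have := hG (simCoins 0 ω) r (Nat.le_of_lt r.2) (.node i)
      omega
  · refine (Data.size_ofList_le
      (k := 1 + (a.eval κ + b.eval κ + κ + P.coinBits.eval κ) * 4) ?_).trans
      (by rw [List.length_ofFn]; exact le_rfl)
    simp only [List.mem_ofFn, forall_exists_index, forall_apply_eq_imp_iff]
    intro j
    refine (Data.size_ofBits_le _).trans ?_
    have hj : (attackBits P a b j).eval κ ≤ a.eval κ + b.eval κ + κ + P.coinBits.eval κ := by
      rcases j with ⟨_ | _ | _ | _ | j, hj⟩ <;> simp [attackBits] <;> omega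
    exact Nat.add_le_add_left (Nat.mul_le_mul_right _ hj) _

end Attack

/-- The simulation costs at most a polynomial in the size of its input and in a bound `G` on the
costs of the code of the protocol. In the second simulation, this code counts only as long as it is
executed. -/
theorem exists_cost_simulate_le (P : Protocol) : ∃ f : Polynomial ℕ, ∀ (x : Data) (G : ℕ),
    (∀ i < P.committee, P.step.cost ((Sim.input P.committee 0 i).eval x) ≤ G) →
    (∀ i < P.committee, ((Prog.due (.coin 0)).eval x).flag = false →
      P.step.cost ((Sim.input P.committee 1 i).eval x) ≤ G) →
    (Sim.simulate P.committee P.step).cost x ≤ f.eval (x.size + G) := by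
  obtain ⟨d, hd⟩ := Prog.IsPoly.due (.coin 0)
  have hl : ∀ c, ∃ f : Polynomial ℕ, ∀ x, ∀ i < P.committee,
      (Sim.input P.committee c i).cost x ≤ f.eval x.size := fun c => by
    obtain ⟨f, hf⟩ := Sim.isPoly_list_map_range (n := P.committee) (Sim.isPoly_input P.committee c)
    exact ⟨f, fun x i hi => (Prog.cost_le_cost_list
      (List.mem_map_of_mem (List.mem_range.2 hi)) x).trans (hf x)⟩
  obtain ⟨f, hf⟩ := hl 0
  obtain ⟨g, hg⟩ := hl 1
  let k : Polynomial ℕ := .C P.committee * (1 + (2 + d + .X + (f + g) + .X)) + (1 + .X)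
  refine ⟨3 * (1 + (k + 1 + .X)) + (1 + .X), fun x G h0 h1 => ?_⟩
  have hx : x.size ≤ x.size + G := Nat.le_add_right _ _
  have hd' := (hd x).trans (eval_le_eval d hx)
  have hf' := fun i hi => (hf x i hi).trans (eval_le_eval f hx)
  have hg' := fun i hi => (hg x i hi).trans (eval_le_eval g hx)
  have hlist : ∀ q : ℕ → Prog, (∀ i < P.committee, (q i).cost x ≤
      2 + d.eval (x.size + G) + (x.size + G) + (f.eval (x.size + G) + g.eval (x.size + G)) +
        (x.size + G)) →
      (Prog.list ((List.range P.committee).map q)).cost x ≤ k.eval (x.size + G) := fun q hq => by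
    refine (Prog.cost_list_le (l := (List.range P.committee).map q)
      (by simpa using hq)).trans ?_
    simp [k]
  have hk0 := hlist (fun i => .comp P.step (Sim.input P.committee 0 i)) fun i hi => by
    have := h0 i hi
    have := hf' i hi
    simp only [Prog.cost]
    omega
  have hk1 := hlist (fun i => Sim.early (.comp P.step (Sim.input P.committee 1 i))) fun i hi => by
    have := hg' i hi
    simp only [Sim.early, Prog.cost]
    split_ifs with hc
    · omega
    · have := h1 i hi (by simpa using hc)
      omega
  refine (Prog.cost_list_le (k := k.eval (x.size + G) + 1 + (x.size + G)) ?_).trans ?_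
  · simp only [List.mem_cons, List.not_mem_nil, or_false, forall_eq_or_imp, forall_eq]
    exact ⟨by simp only [Prog.cost]; omega, by omega, by omega⟩
  · simp

theorem isPPT_attack {P : Protocol} (hP : P.Efficient) (a b : Polynomial ℕ) :
    (attack P a b).IsPPT P := by
  obtain ⟨G, hG, hGt⟩ := exists_time_env_le hP a b
  obtain ⟨f, hf⟩ := exists_cost_simulate_le P
  obtain ⟨g, hg⟩ := Sim.isPoly_conclude P.committee
  let F : ℕ → ℕ := fun κ => 1 + 8 * (1 + ((1 + κ * 2) + (1 + (attack P a b).slots.eval κ * 2) +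
      (1 + 4 * (1 + (1 + P.committee * (1 + (1 + 2 * G κ))))) +
      (1 + (P.committee + P.committee + 4) *
        (1 + (1 + (a.eval κ + b.eval κ + κ + P.coinBits.eval κ) * 4))) +
      (1 + (P.committee + P.committee) * (1 + (1 + (1 + 2 * G κ))))))
  have hF : PolyBounded F := by
    repeat' first
      | exact hG
      | exact .const _
      | exact .self
      | exact .eval _
      | apply PolyBounded.add
      | apply PolyBounded.mul
  refine isPPT_of_cost_le
    (f := fun κ => 1 + f.eval (F κ + G κ) + g.eval (f.eval (F κ + G κ))) P _ ?_ ?_ (.const _)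
  · have h1 := PolyBounded.eval_comp f (hF.add hG)
    exact ((PolyBounded.const 1).add h1).add (.eval_comp g h1)
  · intro κ ω r hr
    have h := attackInvariant ω hr.le
    change (attack P a b).step.cost (attackInput ω ⟨r, hr⟩) ≤ _
    have hs : (Sim.simulate P.committee P.step).cost (attackInput ω ⟨r, hr⟩) ≤
        f.eval (F κ + G κ) := by
      refine (hf _ (G κ) ?_ ?_).trans (eval_le_eval f
        (Nat.add_le_add_right (size_attackInput_le ω ⟨r, hr⟩ (hGt κ)) _))
      · intro i hi
        have := eval_input (r := ⟨r, hr⟩) h (c := 0) (.inl rfl) hi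
        refine (congrArg P.step.cost this).trans_le ?_
        exact cost_env_node_le (simCoins 0 ω) ⟨r, hr⟩ (hGt κ _) (.inl hi)
      · intro i hi hd
        rw [eval_due_zero, Data.flag_ofBool, decide_eq_false_iff_not, not_le] at hd
        have := eval_input (r := ⟨r, hr⟩) h (c := 1) (.inr hd) hi
        refine (congrArg P.step.cost this).trans_le ?_
        exact cost_env_node_le (simCoins 1 ω) ⟨r, hr⟩ (hGt κ _) (.inl hi)
    have hc := (hg ((Sim.simulate P.committee P.step).eval (attackInput ω ⟨r, hr⟩))).trans
      (eval_le_eval g ((Prog.size_eval_le_cost _ _).trans hs))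
    exact Nat.add_le_add (Nat.add_le_add_left hs 1) hc


/-! ### The attack: probabilities -/

section Coordinates

variable {P : Protocol} {a b : Polynomial ℕ} {κ : ℕ}

instance (A : Attacker) : Finite (Coins P A κ) := by unfold Coins; infer_instance
instance (A : Attacker) : Nonempty (Coins P A κ) := by unfold Coins; infer_instance

/-- The coin tosses of the attack with those of the simulated execution `c` replaced. -/
def setSimCoins (c : Fin 2) (ω : Coins P (attack P a b) κ) (ω' : Coins P (env P a b) κ) :
    Coins P (attack P a b) κ :=
  (ω'.1, fun r =>
    (fun i => if i < P.committee then (ω.2 r).1 i else (ω'.2 r).1 i,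
    (ω'.2 r).2.1,
    fun j => match j with
      | ⟨0, _⟩ => (ω'.2 r).2.2 ⟨0, (by decide : 0 < 3)⟩
      | ⟨1, _⟩ => (ω'.2 r).2.2 ⟨1, (by decide : 1 < 3)⟩
      | ⟨2, h⟩ => if c = 0 then (ω'.2 r).2.2 ⟨2, (by decide : 2 < 3)⟩ else (ω.2 r).2.2 ⟨2, h⟩
      | ⟨3, h⟩ => if c = 1 then (ω'.2 r).2.2 ⟨2, (by decide : 2 < 3)⟩ else (ω.2 r).2.2 ⟨3, h⟩
      | ⟨k + 4, h⟩ =>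
        if h' : c * P.committee ≤ k ∧ k < c * P.committee + P.committee then
          (ω'.2 r).1 ⟨k - c * P.committee,
            Nat.lt_of_lt_of_le (by omega : _ < P.committee) (Nat.le_add_right _ _)⟩
        else (ω.2 r).2.2 ⟨k + 4, h⟩))

/-- The coin tosses of a simulated execution as a coordinate of those of the attack. -/
def simCoordinate (c : Fin 2) : Coordinate (Coins P (attack P a b) κ) (Coins P (env P a b) κ) where
  get := simCoins c
  set := setSimCoins c
  get_set ω ω' := by
    refine Prod.ext rfl (funext fun r =>
      Prod.ext (funext fun i => ?_) (Prod.ext rfl (funext fun j => ?_)))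
    · by_cases h : (i : ℕ) < P.committee
      · refine (dif_pos h).trans ((dif_pos (by omega)).trans
          (congrArg (ω'.2 r).1 (Fin.ext ?_)))
        exact Nat.add_sub_cancel_left _ _
      · exact (dif_neg h).trans (if_neg h)
    · rcases j with ⟨_ | _ | _ | j, hj⟩
      · rfl
      · rfl
      · fin_cases c <;> rfl
      · exact absurd (show j + 3 < 3 from hj) (by omega)
  set_set ω ω' ω'' := by
    refine Prod.ext rfl (funext fun r =>
      Prod.ext (funext fun i => ?_) (Prod.ext rfl (funext fun j => ?_)))
    · by_cases h : (i : ℕ) < P.committee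
      · exact (if_pos h).trans ((if_pos h).trans (if_pos h).symm)
      · exact (if_neg h).trans (if_neg h).symm
    · rcases j with ⟨_ | _ | _ | _ | j, hj⟩
      · rfl
      · rfl
      · fin_cases c <;> rfl
      · fin_cases c <;> rfl
      · by_cases h : c * P.committee ≤ j ∧ j < c * P.committee + P.committee
        · refine (dif_pos h).trans ?_
          symm
          exact dif_pos h
        · refine (dif_neg h).trans ((dif_neg h).trans ?_)
          symm
          exact dif_neg h
  set_get ω := by
    refine Prod.ext rfl (funext fun r =>
      Prod.ext (funext fun i => ?_) (Prod.ext rfl (funext fun j => ?_)))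
    · by_cases h : (i : ℕ) < P.committee
      · exact if_pos h
      · exact (if_neg h).trans (dif_neg h)
    · rcases j with ⟨_ | _ | _ | _ | j, hj⟩
      · rfl
      · rfl
      · fin_cases c <;> rfl
      · fin_cases c <;> rfl
      · by_cases h : c * P.committee ≤ j ∧ j < c * P.committee + P.committee
        · have h' : j - c * P.committee < P.committee := by omega
          have key : ∀ k (_ : k = j) (hk : k + 4 < (attack P a b).blocks),
              ((ω.2 r).2.2 ⟨k + 4, hk⟩ : Fin (P.coinBits.eval κ) → Bool) =
                (ω.2 r).2.2 ⟨j + 4, hj⟩ := by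
            rintro _ rfl _; rfl
          refine (dif_pos h).trans ((dif_pos h').trans (key _ ?_ _))
          simp only
          omega
        · exact dif_neg h

/-- The coin tosses of the attack with the first payload of the simulated execution `c` replaced. -/
def setSimPayload (c : Fin 2) (ω : Coins P (attack P a b) κ)
    (y : Fin ((Polynomial.X : Polynomial ℕ).eval κ) → Bool) : Coins P (attack P a b) κ :=
  (ω.1, fun r =>
    ((ω.2 r).1, (ω.2 r).2.1,
    fun j => match j with
      | ⟨0, h⟩ => (ω.2 r).2.2 ⟨0, h⟩
      | ⟨1, h⟩ => (ω.2 r).2.2 ⟨1, h⟩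
      | ⟨2, h⟩ => if c = 0 ∧ (r : ℕ) = 0 then y else (ω.2 r).2.2 ⟨2, h⟩
      | ⟨3, h⟩ => if c = 1 ∧ (r : ℕ) = 0 then y else (ω.2 r).2.2 ⟨3, h⟩
      | ⟨k + 4, h⟩ => (ω.2 r).2.2 ⟨k + 4, h⟩))

theorem slots_attack_pos : 0 < (attack P a b).slots.eval κ := slots_env_pos (P := P)

/-- The first payload of a simulated execution as a coordinate of the coin tosses of the attack. -/
def payloadCoordinate (c : Fin 2) : Coordinate (Coins P (attack P a b) κ)
    (Fin ((Polynomial.X : Polynomial ℕ).eval κ) → Bool) where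
  get ω := simPayload c ω ⟨0, slots_attack_pos⟩
  set := setSimPayload c
  get_set ω y := by
    fin_cases c
    · exact if_pos (c := (0 : Fin 2) = 0 ∧ (0 : ℕ) = 0)
        (e := simPayload 0 ω ⟨0, slots_attack_pos⟩) ⟨rfl, rfl⟩
    · exact if_pos (c := (1 : Fin 2) = 1 ∧ (0 : ℕ) = 0)
        (e := simPayload 1 ω ⟨0, slots_attack_pos⟩) ⟨rfl, rfl⟩
  set_set ω y z := by
    refine Prod.ext rfl (funext fun r =>
      Prod.ext rfl (Prod.ext rfl (funext fun j => ?_)))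
    rcases j with ⟨_ | _ | _ | _ | j, hj⟩ <;> try rfl
    · by_cases h : c = 0 ∧ (r : ℕ) = 0
      · exact (if_pos h).trans (if_pos h).symm
      · exact (if_neg h).trans ((if_neg h).trans (if_neg h).symm)
    · by_cases h : c = 1 ∧ (r : ℕ) = 0
      · exact (if_pos h).trans (if_pos h).symm
      · exact (if_neg h).trans ((if_neg h).trans (if_neg h).symm)
  set_get ω := by
    refine Prod.ext rfl (funext fun r =>
      Prod.ext rfl (Prod.ext rfl (funext fun j => ?_)))
    rcases j with ⟨_ | _ | _ | _ | j, hj⟩ <;> try rfl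
    · by_cases h : c = 0 ∧ (r : ℕ) = 0
      · refine (if_pos h).trans ?_
        obtain ⟨rfl, h⟩ := h
        have : r = ⟨0, slots_attack_pos⟩ := Fin.ext h
        subst this; rfl
      · exact if_neg h
    · by_cases h : c = 1 ∧ (r : ℕ) = 0
      · refine (if_pos h).trans ?_
        obtain ⟨rfl, h⟩ := h
        have : r = ⟨0, slots_attack_pos⟩ := Fin.ext h
        subst this; rfl
      · exact if_neg h

/-- The two simulated executions have independent payloads. -/
theorem simCoins_setSimPayload {c c' : Fin 2} (hc : c ≠ c') (ω : Coins P (attack P a b) κ)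
    (y : Fin ((Polynomial.X : Polynomial ℕ).eval κ) → Bool) :
    simCoins c (setSimPayload c' ω y) = simCoins c ω := by
  refine Prod.ext rfl (funext fun r =>
    Prod.ext rfl (Prod.ext rfl (funext fun j => ?_)))
  rcases j with ⟨_ | _ | j, hj⟩ <;> try rfl
  fin_cases c
  · exact if_neg fun h => hc h.1.symm
  · exact if_neg fun h => hc h.1.symm

theorem prob_simCoins (c : Fin 2) (E : Set (Coins P (env P a b) κ)) :
    prob {ω : Coins P (attack P a b) κ | simCoins c ω ∈ E} = prob E :=
  (simCoordinate c).prob_preimage E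

/-- The payload of one simulated execution occurs in the other one with small probability only. -/
theorem prob_payload_mem_le {c c' : Fin 2} (hc : c ≠ c')
    (L : Coins P (env P a b) κ → Chain) {k : ℕ} (hL : ∀ ω, (L ω).txs.length ≤ k) :
    prob {ω : Coins P (attack P a b) κ |
      payTx (payload (simCoins c' ω) ⟨0, slots_env_pos⟩) ∈ (L (simCoins c ω)).txs} ≤
      (k : ℝ) / 2 ^ κ := by
  have hinj : Function.Injective fun y : Fin ((Polynomial.X : Polynomial ℕ).eval κ) → Bool =>
      payTx (.ofBits y) := fun y z h => Data.ofBits_injective (by simpa [payTx] using h)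
  have h := (payloadCoordinate (P := P) (a := a) (b := b) (κ := κ) c').prob_get_mem_le
    (fun ω => {y | payTx (.ofBits y) ∈ (L (simCoins c ω)).txs}) k
    (fun ω y => by
      change {y | _ ∈ (L (simCoins c (setSimPayload c' ω _))).txs} = _
      rw [simCoins_setSimPayload hc])
    (fun ω => by
      classical
      refine le_trans ?_ (((L (simCoins c ω)).txs.toFinset_card_le).trans (hL _))
      rw [← Set.ncard_coe_finset]
      exact Set.ncard_le_ncard_of_injOn _ (fun y hy => by simpa using hy) hinj.injOn)
  have hcard : (Nat.card (Fin ((Polynomial.X : Polynomial ℕ).eval κ) → Bool) : ℝ) = 2 ^ κ := by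
    rw [Nat.card_fun]; simp
  rwa [hcard] at h

end Coordinates

section Violation

variable {P : Protocol} {a b : Polynomial ℕ} {κ : ℕ} (ω : Coins P (attack P a b) κ)

theorem early_mem_log_attack :
    earlyEntry (simCoins 1 ω) ∈ ((final P (attack P a b) κ ω).loc (.client 0)).log :=
  (attackInvariant ω le_rfl).client_zero_log
    (by rw [show (attack P a b).slots.eval κ = _ from eval_slots_env (P := P)]; omega)

theorem log_attack_client_one :
    ((final P (attack P a b) κ ω).loc (.client 1)).log = [lastEntry (simCoins 0 ω)] :=
  (attackInvariant ω le_rfl).client_one_log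
    (by rw [show (attack P a b).slots.eval κ = _ from eval_slots_env (P := P)]; omega)

/-- The two clients disagree: each of them knows a payload that the other one does not know. -/
theorem violated_attack
    (h0 : payTx (payload (simCoins 0 ω) ⟨0, slots_env_pos⟩) ∈ (lastEntry (simCoins 0 ω)).chain.txs)
    (h1 : payTx (payload (simCoins 1 ω) ⟨0, slots_env_pos⟩) ∈ (earlyEntry (simCoins 1 ω)).chain.txs)
    (h0' : payTx (payload (simCoins 0 ω) ⟨0, slots_env_pos⟩) ∉ (earlyEntry (simCoins 1 ω)).chain.txs)
    (h1' : payTx (payload (simCoins 1 ω) ⟨0, slots_env_pos⟩) ∉ (lastEntry (simCoins 0 ω)).chain.txs) :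
    (final P (attack P a b) κ ω).ViolatedBy ((attack P a b).slots.eval κ) := by
  have hpre : ∀ {L L' : Chain} {t : Data}, L <+: L' → t ∈ L.txs → t ∈ L'.txs := by
    intro L L' t hL ht
    obtain ⟨M, rfl⟩ := hL
    rw [Chain.txs, List.flatMap_append]
    exact List.mem_append_left _ ht
  refine ⟨.client 0, .client 1, _, early_mem_log_attack ω, lastEntry (simCoins 0 ω), ?_,
    (earlySlot P a b κ).2.le, (lastSlot P a b κ).2.le,
    .inl ⟨fun h => h1' (hpre h h1), fun h => h0' (hpre h h0)⟩⟩
  rw [log_attack_client_one]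
  exact List.mem_singleton_self _

/-- Nobody can be punished: all adversarial nodes have withdrawn when client `1` comes online. -/
theorem not_rightlySlashable_attack {f : ℕ} (hf : 0 < f)
    (h : ∀ i < P.committee, i ∈ (lastEntry (simCoins 0 ω)).released) :
    ¬ RightlySlashable P (attack P a b) κ ω f := by
  rintro ⟨⟨S, hS, hadv⟩, -⟩
  obtain ⟨i, hi⟩ := Finset.card_pos.1 (hf.trans_le hS)
  obtain ⟨⟨hN, hadv⟩, hslash⟩ := hadv i hi
  have hinv := attackInvariant ω (le_refl ((attack P a b).slots.eval κ))
  have hi' : i < P.committee := by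
    by_contra hi'
    rcases hadv with hc | hl
    · have := hc.2
      rw [corrupt_attack_eq, decide_eq_true_eq] at this
      exact hi' this
    · have hE := envInvariant (simCoins 0 ω) (le_refl ((env P a b).slots.eval κ))
      have hl' : ((final P (env P a b) κ (simCoins 0 ω)).info i).left = true := by
        rw [← hl]; exact congrArg NodeInfo.left (hinv.info i (not_lt.1 hi')).symm
      have := hE.left i (by rw [hE.asked]; simp [hi'])
      exact absurd (hl'.symm.trans this) (by decide)
  obtain ⟨r, ⟨e, he, her⟩, -, hw⟩ := hslash (.client 1)
    ⟨by rw [log_attack_client_one]; simp, fun _ h => by cases h⟩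
  refine hw ⟨e, he, her, ?_⟩
  rw [log_attack_client_one, List.mem_singleton] at he
  rw [he]
  exact h i hi'

end Violation

end PoS

open PoS in
theorem theorem1 (P : PoS.Protocol) (hP : P.Efficient)
    (T : ℕ → ℕ) (hT : PoS.PolyBounded T) (hW : P.WithdrawalDelay T)
    (fS fL : ℕ) (hS : 0 < fS) (hL : 0 < fL)
    (Tfin : ℕ → ℕ) (hTfin : PoS.PolyBounded Tfin) :
    ¬ (P.SlashableSafety fS ∧ P.Liveness fL Tfin) := by
  rintro ⟨hsafe, hlive⟩
  obtain ⟨a, ha⟩ := hTfin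
  obtain ⟨c, hc⟩ := hT
  -- The payloads are final by slot `a`. The withdrawals, requested in slot `a`, become final within
  -- `Tfin κ` slots, and the stake is released within `T κ` more.
  let b := a + c
  have hb : ∀ κ, Tfin κ + T κ ≤ b.eval κ := fun κ => by
    simpa [b] using Nat.add_le_add (ha κ) (hc κ)
  obtain ⟨G, hG, hGt⟩ := exists_time_env_le hP a b
  have hl := hlive (env P a b) (isPPT_env hP a b) fun κ => by rw [corruptions_env]; omega
  have hw := hW (env P a b) (isPPT_env hP a b) (corruptions_env P a b) (fillsQueue_env P a b)
  have hs := hsafe (attack P a b) (isPPT_attack hP a b)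
  have hg := Negligible.polyBounded_div_two_pow hG
  -- All bad events are negligible, but together they cover the probability space.
  obtain ⟨κ, hκ⟩ := (hs.add ((hl.add hl).add (hw.add (hg.add hg)))).exists_lt_one
  refine hκ.not_ge ?_
  let Ω := Coins P (attack P a b) κ
  let live : Fin 2 → Set Ω := fun c =>
    {ω | simCoins c ω ∈ {ω' | ¬ LiveWithin P (env P a b) κ ω' (Tfin κ)}}
  let rel : Set Ω :=
    {ω | simCoins 0 ω ∈ {ω' | ¬ ReleasedWithin P (env P a b) κ ω' (T κ)}}
  let early : Set Ω := {ω | payTx (payload (simCoins 0 ω) ⟨0, slots_env_pos⟩) ∈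
    (earlyEntry (simCoins 1 ω)).chain.txs}
  let last : Set Ω := {ω | payTx (payload (simCoins 1 ω) ⟨0, slots_env_pos⟩) ∈
    (lastEntry (simCoins 0 ω)).chain.txs}
  let bad : Set Ω := {ω | (final P (attack P a b) κ ω).ViolatedBy ((attack P a b).slots.eval κ) ∧
    ¬ RightlySlashable P (attack P a b) κ ω fS}
  have hcover : (Set.univ : Set Ω) ⊆ bad ∪ ((live 0 ∪ live 1) ∪ (rel ∪ (early ∪ last))) := by
    intro ω _
    by_contra hω
    simp only [Set.mem_union, not_or] at hω
    obtain ⟨hbad, ⟨hl0, hl1⟩, hr, he, hlast⟩ := hω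
    have hl0 := not_not.1 hl0
    have hl1 := not_not.1 hl1
    have hr := not_not.1 hr
    exact hbad ⟨violated_attack ω (payload_mem_of_live _ (ha κ) hl0).2
        (payload_mem_of_live _ (ha κ) hl1).1 he hlast,
      not_rightlySlashable_attack ω hS fun i hi => released_of_live _ (hb κ) hl0 hr hi⟩
  calc (1 : ℝ) = prob (Set.univ : Set Ω) := prob_univ.symm
    _ ≤ prob (bad ∪ ((live 0 ∪ live 1) ∪ (rel ∪ (early ∪ last)))) := prob_mono hcover
    _ ≤ prob bad + ((prob (live 0) + prob (live 1)) + (prob rel + (prob early + prob last))) :=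
      (prob_union_le _ _).trans (add_le_add le_rfl ((prob_union_le _ _).trans (add_le_add
        (prob_union_le _ _) ((prob_union_le _ _).trans (add_le_add le_rfl (prob_union_le _ _))))))
    _ ≤ _ := by
      refine add_le_add le_rfl (add_le_add (add_le_add ?_ ?_) (add_le_add ?_ (add_le_add ?_ ?_)))
      · exact (prob_simCoins 0 _).le
      · exact (prob_simCoins 1 _).le
      · exact (prob_simCoins 0 _).le
      · exact prob_payload_mem_le (by decide) (fun ω => (earlyEntry ω).chain)
          fun ω => length_txs_earlyEntry_le ω (hGt κ ω)
      · exact prob_payload_mem_le (by decide) (fun ω => (lastEntry ω).chain)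
          fun ω => length_txs_lastEntry_le ω (hGt κ ω)
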